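/- Let $k$ be any field, $Q=k[[x,y,z,w]]$, $P=k[X,Y,Z,W]$, and for $n\geq 1$ let $$\mathfrak p_n=(x^2-z^{2n+1}w,\ xy-z^{n+1}w^{n+1},\ y^2-zw^{2n+1},\ yz^n-xw^n)\subseteq Q,\qquad R_n=Q/\mathfrak p_n,$$ with maximal ideal $\mathfrak m_n$. For a power series $0\neq f\in Q$ let $\mathrm{in}(f)\in P$ be its homogeneous component of lowest degree, let $\mathrm{in}(\mathfrak p_n)=(\mathrm{in}(f) : 0\ne f\in\mathfrak p_n)$, and let $G_n=P/\mathrm{in}(\mathfrak p_n)$. For a Noetherian local ring $(R,\mathfrak m)$ of dimension $d$, let $\mathrm{HF}_R(j)=\dim_{R/\mathfrak m}\mathfrak m^j/\mathfrak m^{j+1}$, write $\sum_{j\ge 0}\mathrm{HF}_R(j)t^j=h(t)/(1-t)^d$ with $h\in\mathbb Z[t]$, and let $e(R)=h(1)$ be the multiplicity and $e_1(R)=h'(1)$; let $\mu(\mathfrak m)$ be the minimal number of generators of $\mathfrak m$. The Hilbert polynomial $\mathrm{HP}_n$ of $G_n$ is the polynomial with $\mathrm{HP}_n(j)=\sum_{i\le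 j}\dim_k (G_n)_i$ for all $j\gg 0$. Then for every $n\geq 1$: 1. $\mathfrak p_n$ is a prime ideal, and $R_n$ is a complete Noetherian local domain of dimension $2$ with an isolated singularity (its localization at a prime is regular exactly when the prime is not $\mathfrak m_n$). The $k$-algebra homomorphism $\varphi_n:Q\to k[[s,t]]$ given by substituting $x\mapsto st^{2n+1}$, $y\mapsto s^{2n+1}t$, $z\mapsto t^2$, $w\mapsto s^2$ induces an isomorphism $R_n\cong k[[st^{2n+1},s^{2n+1}t,t^2,s^2]]$ onto its image. 2. $e(R_n)=2$, $e_1(R_n)=1-n$ and $\mu(\mathfrak m_n)=4$. In particular $R_n$ does not satisfy Abhyankar's inequality: $e(R_n)<\operatorname{height}_Q(\mathfrak p_n)+1$ and $e(R_n)<\mu(\mathfrak m_n)-\dim R_n+1$. 3. $G_n$ is the associated graded ring of $R_n$: there is an isomorphism of $k$-algebras $G_n\cong \mathrm{gr}_{\mathfrak m_n}(R_n)=\bigoplus_{j\geq 0}\mathfrak m_n^j/\mathfrak m_n^{j+1}$ sending the classes of $X,Y,Z,W$ to the classes of $x,y,z,w$ in $\mathfrak m_n/\mathfrak m_n^2$.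 Moreover $\mathrm{in}(\mathfrak p_n)=(X^2,XY,Y^2,YZ^n-XW^n)$; this ideal is primary with radical $(X,Y)$; and $G_n$ satisfies Serre's condition $(S_1)$ and is unmixed, i.e. $\dim G_n/\mathfrak q=\dim G_n$ for every associated prime $\mathfrak q$ of $G_n$. 4. The Hilbert polynomial $\mathrm{HP}_n$ of $G_n$ exists, it satisfies $\mathrm{HP}_n(j)=\ell_{R_n}(R_n/\mathfrak m_n^{j+1})$ for all $j\gg 0$, and $\mathrm{HP}_n\neq\mathrm{HP}_{n'}$ for all $n,n'\geq 1$ with $n\neq n'$. -/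

import Mathlib

open IsLocalRing

noncomputable section

/-! ### Invariants of local rings -/

/-- The singular locus of the local ring `A` is exactly its closed point: the localization at
a prime is regular if and only if the prime is not the maximal ideal. -/
def HasIsolatedSingularity (A : Type*) [CommRing A] [IsLocalRing A] : Prop :=
  ∀ (P : Ideal A) [P.IsPrime],
    IsRegularLocalRing (Localization.AtPrime P) ↔ P ≠ maximalIdeal A

/-- The Hilbert function `j ↦ dim_{A/𝔪} (𝔪^j / 𝔪^{j+1})` of a local ring. -/
def hilbertFunction (A : Type*) [CommRing A] [IsLocalRing A] (j : ℕ) : ℕ :=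
  Module.finrank (A ⧸ maximalIdeal A)
    (↥(maximalIdeal A ^ j) ⧸
      (maximalIdeal A • ⊤ : Submodule A ↥(maximalIdeal A ^ j)))

/-- `h` is the numerator of the Hilbert series of `A`: `∑ HF_A(j) t^j = h(t) / (1 - t)^d`
with `d = dim A`. Such an `h` is unique. -/
def IsHPolynomial (A : Type*) [CommRing A] [IsLocalRing A] (h : Polynomial ℤ) : Prop :=
  ∃ d : ℕ, ringKrullDim A = d ∧
    (h : PowerSeries ℤ) =
      (1 - PowerSeries.X) ^ d * PowerSeries.mk (fun j => (hilbertFunction A j : ℤ))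

open scoped Classical in
/-- The `i`-th Hilbert coefficient `e_i(A) = h^{(i)}(1) / i!`; in particular
`e_0(A) = h(1)` is the multiplicity and `e_1(A) = h'(1)`.
(The value is `0` if the Hilbert series has no such numerator `h`.) -/
def hilbertCoeff (A : Type*) [CommRing A] [IsLocalRing A] (i : ℕ) : ℤ :=
  if H : ∃ h : Polynomial ℤ, IsHPolynomial A h then
    (Polynomial.hasseDeriv i H.choose).eval 1
  else 0

/-- `f` is the Hilbert(-Samuel) polynomial of the local ring `A`:
the length of `A / 𝔪^{j+1}` equals `f(j)` for `j ≫ 0`. -/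
def IsHilbertPolynomial (A : Type*) [CommRing A] [IsLocalRing A] (f : Polynomial ℚ) : Prop :=
  ∀ᶠ j : ℕ in Filter.atTop, ∃ l : ℕ,
    Module.length A (A ⧸ maximalIdeal A ^ (j + 1)) = l ∧ f.eval (j : ℚ) = l

/-- The depth of a local ring: the supremum of the lengths of the regular sequences contained
in its maximal ideal. -/
def localDepth (A : Type*) [CommRing A] [IsLocalRing A] : ℕ∞ :=
  ⨆ rs : {rs : List A // (∀ r ∈ rs, r ∈ maximalIdeal A) ∧
    RingTheory.Sequence.IsRegular A rs}, (rs.1.length : ℕ∞)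

/-- Serre's condition `(S_r)`: `depth A_P ≥ min(r, dim A_P)` for every prime `P`. -/
def SerreCondition (r : ℕ) (A : Type*) [CommRing A] : Prop :=
  ∀ (P : Ideal A) [P.IsPrime],
    min (r : WithBot ℕ∞) (ringKrullDim (Localization.AtPrime P)) ≤
      ((localDepth (Localization.AtPrime P) : ℕ∞) : WithBot ℕ∞)

/-- All associated primes of `A` have the same dimension as `A`. -/
def IsUnmixedRing (A : Type*) [CommRing A] : Prop :=
  ∀ P ∈ associatedPrimes A A, ringKrullDim (A ⧸ P) = ringKrullDim A

/-- The associated graded ring `gr_I(A) = ⨁_j I^j / I^{j+1}`, as the quotient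
`A[IT] / I A[IT]` of the Rees algebra `A[IT] = ⨁_j I^j T^j`. -/
abbrev AssocGraded {A : Type*} [CommRing A] (I : Ideal A) : Type _ :=
  ↥(reesAlgebra I) ⧸ I.map (algebraMap A ↥(reesAlgebra I))

/-- The class in degree `j` of `gr_I(A)` of an element of `I^j`. -/
def AssocGraded.of {A : Type*} [CommRing A] (I : Ideal A) (j : ℕ) (a : A) (ha : a ∈ I ^ j) :
    AssocGraded I :=
  Ideal.Quotient.mk _ ⟨Polynomial.monomial j a, reesAlgebra.monomial_mem.mpr ha⟩

/-! ### Initial ideals -/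

/-- The initial form of a power series `f ≠ 0` in finitely many variables: the homogeneous part
of `f` of degree equal to the order of `f`, as a polynomial. -/
def initialForm {σ : Type*} [Fintype σ] [DecidableEq σ] {k : Type*} [Field k]
    (f : MvPowerSeries σ k) : MvPolynomial σ k :=
  ∑ m ∈ Finset.finsuppAntidiag (Finset.univ : Finset σ) f.order.toNat,
    MvPolynomial.monomial m (MvPowerSeries.coeff m f)

/-- The initial ideal `in(I)`, generated by the initial forms of the nonzero elements of `I`. -/
def initialIdeal {σ : Type*} [Fintype σ] [DecidableEq σ] {k : Type*} [Field k]
    (I : Ideal (MvPowerSeries σ k)) : Ideal (MvPolynomial σ k) :=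
  Ideal.span {g | ∃ f ∈ I, f ≠ 0 ∧ g = initialForm f}

/-- The Hilbert function of the standard graded algebra `P/J` (`J` a homogeneous ideal of the
polynomial ring `P`): the `k`-dimension of the space of classes of forms of degree `j`. -/
def gradedHilbertFunction {σ : Type*} {k : Type*} [Field k] (J : Ideal (MvPolynomial σ k))
    (j : ℕ) : ℕ :=
  Module.finrank k
    ↥((MvPolynomial.homogeneousSubmodule σ k j).map (Ideal.Quotient.mkₐ k J).toLinearMap)

/-- `f` is the Hilbert polynomial of `G = P/J`, in the cumulative (Hilbert-Samuel) convention: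
`f(j) = ∑_{i ≤ j} dim_k G_i` for `j ≫ 0`. -/
def IsGradedHilbertPolynomial {σ : Type*} {k : Type*} [Field k] (J : Ideal (MvPolynomial σ k))
    (f : Polynomial ℚ) : Prop :=
  ∀ᶠ j : ℕ in Filter.atTop,
    f.eval (j : ℚ) = ((∑ i ∈ Finset.range (j + 1), gradedHilbertFunction J i : ℕ) : ℚ)

/-! ### The family of ideals; the variables `x, y, z, w` are indexed by `0, 1, 2, 3`, and
`s, t` by `0, 1`. -/

namespace AbhyankarFamily

open MvPowerSeries in
/-- The ideal
`𝔭_n = (x² - z^{2n+1} w, xy - z^{n+1} w^{n+1}, y² - z w^{2n+1}, y z^n - x w^n)` of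
`k[[x, y, z, w]]`. -/
def p (k : Type*) [Field k] (n : ℕ) : Ideal (MvPowerSeries (Fin 4) k) :=
  Ideal.span
    {X 0 ^ 2 - X 2 ^ (2 * n + 1) * X 3,
     X 0 * X 1 - X 2 ^ (n + 1) * X 3 ^ (n + 1),
     X 1 ^ 2 - X 2 * X 3 ^ (2 * n + 1),
     X 1 * X 2 ^ n - X 0 * X 3 ^ n}

/-- The ring `R_n = k[[x, y, z, w]] / 𝔭_n`. -/
abbrev R (k : Type*) [Field k] (n : ℕ) : Type _ := MvPowerSeries (Fin 4) k ⧸ p k n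

open MvPolynomial in
/-- The ideal `(X², XY, Y², Y Z^n - X W^n)` of `k[X, Y, Z, W]`. -/
def J (k : Type*) [Field k] (n : ℕ) : Ideal (MvPolynomial (Fin 4) k) :=
  Ideal.span {X 0 ^ 2, X 0 * X 1, X 1 ^ 2, X 1 * X 2 ^ n - X 0 * X 3 ^ n}

/-- The ring `G_n = k[X, Y, Z, W] / in(𝔭_n)`. -/
abbrev G (k : Type*) [Field k] (n : ℕ) : Type _ :=
  MvPolynomial (Fin 4) k ⧸ initialIdeal (p k n)

theorem p_ne_top (k : Type*) [Field k] (n : ℕ) : p k n ≠ ⊤ := by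
  have h : p k n ≤ RingHom.ker (MvPowerSeries.constantCoeff (σ := Fin 4) (R := k)) := by
    rw [p, Ideal.span_le]
    intro f hf
    simp only [Set.mem_insert_iff, Set.mem_singleton_iff] at hf
    rcases hf with rfl | rfl | rfl | rfl <;> simp [RingHom.mem_ker]
  intro htop
  rw [htop, top_le_iff] at h
  exact RingHom.ker_ne_top _ h

instance (k : Type*) [Field k] (n : ℕ) : Nontrivial (R k n) :=
  Ideal.Quotient.nontrivial_iff.mpr (p_ne_top k n)

instance (k : Type*) [Field k] (n : ℕ) : IsLocalRing (R k n) :=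
  IsLocalRing.of_surjective' (Ideal.Quotient.mk (p k n)) Ideal.Quotient.mk_surjective

open MvPowerSeries in
/-- The four power series `s t^{2n+1}, s^{2n+1} t, t², s²` in `k[[s, t]]`. -/
def param (k : Type*) [Field k] (n : ℕ) : Fin 4 → MvPowerSeries (Fin 2) k :=
  ![X 0 * X 1 ^ (2 * n + 1), X 0 ^ (2 * n + 1) * X 1, X 1 ^ 2, X 0 ^ 2]

theorem hasSubst_param (k : Type*) [Field k] (n : ℕ) : MvPowerSeries.HasSubst (param k n) := by
  apply MvPowerSeries.hasSubst_of_constantCoeff_zero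
  intro i
  fin_cases i <;> simp [param]

/-- The substitution homomorphism `φ_n : k[[x, y, z, w]] → k[[s, t]]`,
`x ↦ s t^{2n+1}`, `y ↦ s^{2n+1} t`, `z ↦ t²`, `w ↦ s²`. -/
def phi (k : Type*) [Field k] (n : ℕ) : MvPowerSeries (Fin 4) k →ₐ[k] MvPowerSeries (Fin 2) k :=
  MvPowerSeries.substAlgHom (hasSubst_param k n)

/-- The subring `k[[s t^{2n+1}, s^{2n+1} t, t², s²]]` of `k[[s, t]]`: all power series in the four
given elements. -/
def paramSubalgebra (k : Type*) [Field k] (n : ℕ) : Subalgebra k (MvPowerSeries (Fin 2) k) :=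
  (phi k n).range

end AbhyankarFamily

end

/-! The map `φ_n` sends monomials to monomials. The four generators of `𝔭_n` are binomials in its
kernel, and they rewrite every monomial to a normal one: `z^c w^e`, `x z^c w^e`, or `y z^c w^e` with
`c < n`. Rewriting keeps the image, never lowers the degree, and distinct normal monomials have
distinct images (`exists_isNormal_sub_mem`, `IsNormal.eq_of_imgExp_eq`). So the coefficients of
`φ_n(f)` give a normal form of `f`, congruent to `f` modulo `𝔭_n` first for polynomials and then,
ideals being closed, for all power series. Hence `𝔭_n = ker φ_n` is prime. Since degrees do not
drop, `𝔪^j` consists of the classes whose normal form has order at least `j`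
(`mem_maximalIdeal_pow_iff`). The Hilbert function therefore counts normal monomials of degree `j`,
which is `2j + 1 + min(j, n)`, and the numerical invariants follow from this count together with the
dimension.

The dimension comes from Krull's height theorem for `(z, w)` and an explicit chain of primes. For
the singular locus, every element of `k[[s, t]]` that is a fraction of `R_n` has only terms of even
degree, and `z^n`, `w^n` multiply such series into the image of `R_n`. A prime other than `𝔪` misses
`z` or `w`, so its localization is normal of dimension at most one, hence regular. At `𝔪` the
embedding dimension 4 exceeds the dimension 2.

For the graded side, `J ≤ in(𝔭_n) ≤ ker(P → gr)` is direct. Modulo `J` every polynomial is congruent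
to a combination of normal monomials, and these combinations inject into `gr`, so all three ideals
agree. Finally `J` is the kernel of a map to the dual numbers over the domain `k[Z, W]`
(`mem_J_iff`), which shows that it is primary with radical `(X, Y)`. A ring with primary zero ideal
is unmixed and satisfies `(S₁)`. -/

noncomputable section

/-! ### Powers of the maximal ideal of a power series ring, and closedness of its ideals. -/

namespace MvPowerSeries

variable {σ : Type*} {k : Type*}

/-- The power series with a given family of coefficients. -/
def ofCoeff (c : (σ →₀ ℕ) → k) : MvPowerSeries σ k := c

@[simp]
theorem coeff_ofCoeff [CommRing k] (c : (σ →₀ ℕ) → k) (d : σ →₀ ℕ) : coeff d (ofCoeff c) = c d :=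
  rfl

theorem coeff_X_mul_eq_ite [CommRing k] [DecidableEq σ] (i : σ) (f : MvPowerSeries σ k)
    (d : σ →₀ ℕ) :
    coeff d (X i * f) = if d i = 0 then 0 else coeff (d - Finsupp.single i 1) f := by
  rw [X, coeff_monomial_mul]
  by_cases h : d i = 0
  · simp [h]
  · simp [h, Nat.one_le_iff_ne_zero]

/-- Each nonzero exponent `d` is assigned one variable `c d` dividing the monomial. The series `g i`
collects the terms assigned to `i`, divided by `X i`. -/
theorem exists_eq_sum_X_mul [CommRing k] [Fintype σ] {f : MvPowerSeries σ k} {j : ℕ}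
    (hf : ∀ d : σ →₀ ℕ, d.degree < j + 1 → coeff d f = 0) :
    ∃ g : σ → MvPowerSeries σ k, f = ∑ i, X i * g i ∧
      ∀ i, ∀ d : σ →₀ ℕ, d.degree < j → coeff d (g i) = 0 := by
  classical
  have hne : ∀ d : σ →₀ ℕ, d ≠ 0 → ∃ i, d i ≠ 0 := fun d hd => by
    by_contra! h
    exact hd (Finsupp.ext h)
  rcases isEmpty_or_nonempty σ with hσ | hσ
  · refine ⟨0, ?_, by simp⟩
    ext d
    simpa using hf d (by simp [Subsingleton.elim d 0])
  choose! c hc using hne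
  refine ⟨fun i => ofCoeff fun d =>
    if c (d + Finsupp.single i 1) = i then coeff (d + Finsupp.single i 1) f else 0,
    ?_, ?_⟩
  · ext d
    rw [map_sum]
    simp only [coeff_X_mul_eq_ite]
    by_cases hd : d = 0
    · subst hd
      simp only [Finsupp.coe_zero, Pi.zero_apply, if_true, Finset.sum_const_zero]
      exact hf 0 (by simp)
    · rw [Finset.sum_eq_single (c d)]
      · rw [if_neg (hc d hd), coeff_ofCoeff]
        have : d - Finsupp.single (c d) 1 + Finsupp.single (c d) 1 = d :=
          tsub_add_cancel_of_le (by simpa [Nat.one_le_iff_ne_zero] using hc d hd)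
        rw [this, if_pos rfl]
      · intro i _ hi
        split_ifs with h
        · rfl
        · rw [coeff_ofCoeff]
          have : d - Finsupp.single i 1 + Finsupp.single i 1 = d :=
            tsub_add_cancel_of_le (by simpa [Nat.one_le_iff_ne_zero] using h)
          rw [this, if_neg (Ne.symm hi)]
      · simp
  · intro i d hd
    rw [coeff_ofCoeff]
    split_ifs with h
    · apply hf
      rw [map_add, Finsupp.degree_single]
      lia
    · rfl

/-- The `j`-th power of the ideal of the variables consists of the power series of order at
least `j`. -/
theorem mem_span_X_pow_iff [CommRing k] [Fintype σ] {f : MvPowerSeries σ k} {j : ℕ} :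
    f ∈ (Ideal.span (Set.range X) : Ideal (MvPowerSeries σ k)) ^ j ↔
      ∀ d : σ →₀ ℕ, d.degree < j → coeff d f = 0 := by
  classical
  induction j generalizing f with
  | zero => simp
  | succ j ih =>
    constructor
    · intro hf
      rw [pow_succ'] at hf
      refine Submodule.mul_induction_on hf ?_ ?_
      · intro a ha b hb
        rw [ih] at hb
        induction ha using Submodule.span_induction with
        | mem x hx =>
          obtain ⟨i, rfl⟩ := hx
          intro d hd
          rw [coeff_X_mul_eq_ite]
          split_ifs with h
          · rfl
          · apply hb
            have : d - Finsupp.single i 1 + Finsupp.single i 1 = d :=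
              tsub_add_cancel_of_le (by simpa [Nat.one_le_iff_ne_zero] using h)
            have h2 := congrArg Finsupp.degree this
            rw [map_add, Finsupp.degree_single] at h2
            lia
        | zero => simp
        | add x y _ _ hx hy =>
          intro d hd
          rw [add_mul, map_add, hx d hd, hy d hd, add_zero]
        | smul a x _ hx =>
          intro d hd
          rw [smul_eq_mul, mul_assoc, coeff_mul]
          refine Finset.sum_eq_zero fun p hp => ?_
          rw [Finset.HasAntidiagonal.mem_antidiagonal] at hp
          rw [hx p.2, mul_zero]
          have := congrArg Finsupp.degree hp
          rw [map_add] at this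
          lia
      · intro x y hx hy d hd
        rw [map_add, hx d hd, hy d hd, add_zero]
    · intro hf
      obtain ⟨g, rfl, hg⟩ := exists_eq_sum_X_mul hf
      rw [pow_succ']
      exact Ideal.sum_mem _ fun i _ =>
        Ideal.mul_mem_mul (Ideal.subset_span ⟨i, rfl⟩) (ih.2 (hg i))

theorem maximalIdeal_eq_span_X [Field k] [Fintype σ] :
    maximalIdeal (MvPowerSeries σ k) = Ideal.span (Set.range X) := by
  classical
  ext f
  rw [← pow_one (Ideal.span (Set.range X)), mem_span_X_pow_iff, mem_maximalIdeal, mem_nonunits_iff,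
    isUnit_iff_constantCoeff, isUnit_iff_ne_zero, not_not]
  constructor
  · intro h d hd
    have : d = 0 := by rwa [Nat.lt_one_iff, Finsupp.degree_eq_zero_iff] at hd
    rw [this, coeff_zero_eq_constantCoeff_apply, h]
  · intro h
    rw [← coeff_zero_eq_constantCoeff_apply, h 0 (by simp)]

/-- Ideals of power series rings over a field are closed. -/
theorem mem_of_forall_mem_sup_pow [Field k] [Fintype σ] {I : Ideal (MvPowerSeries σ k)}
    {f : MvPowerSeries σ k}
    (h : ∀ j, f ∈ I ⊔ (Ideal.span (Set.range X)) ^ j) : f ∈ I := by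
  by_cases hI : I = ⊤
  · simp [hI]
  have : Nontrivial (MvPowerSeries σ k ⧸ I) := Ideal.Quotient.nontrivial_iff.mpr hI
  have : IsLocalRing (MvPowerSeries σ k ⧸ I) :=
    IsLocalRing.of_surjective' (Ideal.Quotient.mk I) Ideal.Quotient.mk_surjective
  -- Krull's intersection theorem in the Noetherian local ring `k[[σ]] / I`.
  have hb := Ideal.iInf_pow_eq_bot_of_isLocalRing
    ((maximalIdeal (MvPowerSeries σ k)).map (Ideal.Quotient.mk I))
    (by
      rw [IsLocalRing.map_maximalIdeal_of_surjective _ Ideal.Quotient.mk_surjective]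
      exact (maximalIdeal.isMaximal _).ne_top)
  rw [← Ideal.Quotient.eq_zero_iff_mem, ← Ideal.mem_bot, ← hb, Ideal.mem_iInf]
  intro j
  rw [← Ideal.map_pow, maximalIdeal_eq_span_X]
  have := Ideal.mem_map_of_mem (Ideal.Quotient.mk I) (h j)
  rwa [Ideal.map_sup, Ideal.map_quotient_self, bot_sup_eq] at this

end MvPowerSeries

/-! ### Normal monomials, normal forms, and the kernel of `φ_n`. -/

namespace AbhyankarFamily

/-- The exponent `(a, b, c, e)` of the monomial `x^a y^b z^c w^e`. -/
def expo (a b c e : ℕ) : Fin 4 →₀ ℕ := Finsupp.equivFunOnFinite.symm ![a, b, c, e]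

@[simp] theorem expo_zero (a b c e : ℕ) : expo a b c e 0 = a := rfl
@[simp] theorem expo_one (a b c e : ℕ) : expo a b c e 1 = b := rfl
@[simp] theorem expo_two (a b c e : ℕ) : expo a b c e 2 = c := rfl
@[simp] theorem expo_three (a b c e : ℕ) : expo a b c e 3 = e := rfl

theorem ext_fin_four {d d' : Fin 4 →₀ ℕ} (h0 : d 0 = d' 0) (h1 : d 1 = d' 1) (h2 : d 2 = d' 2)
    (h3 : d 3 = d' 3) : d = d' := by
  ext i
  fin_cases i <;> assumption

theorem expo_eta (d : Fin 4 →₀ ℕ) : expo (d 0) (d 1) (d 2) (d 3) = d :=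
  ext_fin_four rfl rfl rfl rfl

theorem degree_fin_four (d : Fin 4 →₀ ℕ) : d.degree = d 0 + d 1 + d 2 + d 3 := by
  rw [Finsupp.degree_eq_sum, Fin.sum_univ_four]

/-- The exponent of the image of a monomial under `φ_n`. -/
def imgExp (n : ℕ) (d : Fin 4 →₀ ℕ) : Fin 2 →₀ ℕ :=
  Finsupp.equivFunOnFinite.symm
    ![d 0 + (2 * n + 1) * d 1 + 2 * d 3, (2 * n + 1) * d 0 + d 1 + 2 * d 2]

@[simp] theorem imgExp_zero (n : ℕ) (d : Fin 4 →₀ ℕ) :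
    imgExp n d 0 = d 0 + (2 * n + 1) * d 1 + 2 * d 3 := rfl
@[simp] theorem imgExp_one (n : ℕ) (d : Fin 4 →₀ ℕ) :
    imgExp n d 1 = (2 * n + 1) * d 0 + d 1 + 2 * d 2 := rfl

theorem ext_fin_two {d d' : Fin 2 →₀ ℕ} (h0 : d 0 = d' 0) (h1 : d 1 = d' 1) : d = d' := by
  ext i
  fin_cases i <;> assumption

theorem imgExp_eq_iff {n : ℕ} {d : Fin 4 →₀ ℕ} {μ : Fin 2 →₀ ℕ} :
    imgExp n d = μ ↔ d 0 + (2 * n + 1) * d 1 + 2 * d 3 = μ 0 ∧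
      (2 * n + 1) * d 0 + d 1 + 2 * d 2 = μ 1 :=
  ⟨by rintro rfl; simp, fun h => ext_fin_two h.1 h.2⟩

/-- The exponents of the monomials `z^c w^e`, `x z^c w^e` and `y z^c w^e` with `c < n`. -/
def IsNormal (n : ℕ) (d : Fin 4 →₀ ℕ) : Prop :=
  (d 1 = 0 ∧ d 0 ≤ 1) ∨ (d 0 = 0 ∧ d 1 = 1 ∧ d 2 < n)

instance (n : ℕ) : DecidablePred (IsNormal n) := fun _ => by unfold IsNormal; infer_instance

/-- The parity of the exponent of `t` separates `z^c w^e` from the other two kinds. For `x z^c w^e`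
that exponent is at least `2n + 1`, while for `y z^c w^e` with `c < n` it is smaller. -/
theorem IsNormal.eq_of_imgExp_eq {n : ℕ} {d d' : Fin 4 →₀ ℕ} (hd : IsNormal n d)
    (hd' : IsNormal n d') (h : imgExp n d = imgExp n d') : d = d' := by
  rw [imgExp_eq_iff, imgExp_zero, imgExp_one] at h
  obtain ⟨h0, h1⟩ := h
  rcases hd with ⟨a1, a2⟩ | ⟨a0, a1, a2⟩ <;> rcases hd' with ⟨b1, b2⟩ | ⟨b0, b1, b2⟩
  · rw [a1, b1] at h0 h1
    have : d 0 = d' 0 := by lia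
    rw [this] at h0 h1
    exact ext_fin_four this (by lia) (by lia) (by lia)
  · rw [a1, b1, b0] at h0 h1
    have : d 0 = 1 := by lia
    rw [this] at h1
    lia
  · rw [b1, a1, a0] at h0 h1
    have : d' 0 = 1 := by lia
    rw [this] at h1
    lia
  · rw [a0, b0, a1, b1] at h0 h1
    exact ext_fin_four (by lia) (by lia) (by lia) (by lia)

section monomials

variable {k : Type*} [Field k]

theorem monomial_expo (a b c e : ℕ) : MvPowerSeries.monomial (expo a b c e) (1 : k) =
    MvPowerSeries.X 0 ^ a * MvPowerSeries.X 1 ^ b * MvPowerSeries.X 2 ^ c *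
      MvPowerSeries.X 3 ^ e := by
  simp only [MvPowerSeries.X_pow_eq, MvPowerSeries.monomial_mul_monomial, mul_one]
  congr 2
  apply ext_fin_four <;> simp

theorem mvPolynomial_monomial_expo (a b c e : ℕ) : MvPolynomial.monomial (expo a b c e) (1 : k) =
    MvPolynomial.X 0 ^ a * MvPolynomial.X 1 ^ b * MvPolynomial.X 2 ^ c *
      MvPolynomial.X 3 ^ e := by
  simp only [MvPolynomial.X_pow_eq_monomial, MvPolynomial.monomial_mul, mul_one]
  congr 2
  apply ext_fin_four <;> simp

/-- Every monomial is congruent modulo `𝔭_n` to a normal one, of at least the same degree. -/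
theorem exists_isNormal_sub_mem (n : ℕ) (d : Fin 4 →₀ ℕ) :
    ∃ d', IsNormal n d' ∧ imgExp n d' = imgExp n d ∧ d.degree ≤ d'.degree ∧
      MvPowerSeries.monomial d (1 : k) - MvPowerSeries.monomial d' 1 ∈ p k n := by
  -- The measure `2(a + b) + b` drops at each rewriting: the three quadratic relations lower `a +
  -- b`, and `y z^n → x w^n` keeps `a + b` but lowers `b`.
  have key : ∀ m a b c e : ℕ, 2 * (a + b) + b = m → ∃ d', IsNormal n d' ∧
      imgExp n d' = imgExp n (expo a b c e) ∧ (expo a b c e).degree ≤ d'.degree ∧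
      MvPowerSeries.monomial (expo a b c e) (1 : k) - MvPowerSeries.monomial d' 1 ∈ p k n := by
    intro m
    induction m using Nat.strong_induction_on with
    | _ m ih =>
      intro a b c e hm
      have step : ∀ a' b' c' e' : ℕ, 2 * (a' + b') + b' < m →
          imgExp n (expo a' b' c' e') = imgExp n (expo a b c e) →
          (expo a b c e).degree ≤ (expo a' b' c' e').degree →
          MvPowerSeries.monomial (expo a b c e) (1 : k) -
            MvPowerSeries.monomial (expo a' b' c' e') 1 ∈ p k n →
          ∃ d', IsNormal n d' ∧
      imgExp n d' = imgExp n (expo a b c e) ∧ (expo a b c e).degree ≤ d'.degree ∧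
      MvPowerSeries.monomial (expo a b c e) (1 : k) - MvPowerSeries.monomial d' 1 ∈ p k n := by
        intro a' b' c' e' hlt h1 h2 h3
        obtain ⟨d', g1, g2, g3, g4⟩ := ih _ hlt a' b' c' e' rfl
        refine ⟨d', g1, g2.trans h1, h2.trans g3, ?_⟩
        have := Ideal.add_mem _ h3 g4
        rwa [sub_add_sub_cancel] at this
      by_cases ha : 2 ≤ a
      · obtain ⟨a, rfl⟩ := Nat.exists_eq_add_of_le ha
        refine step a b (c + (2 * n + 1)) (e + 1) (by lia) ?_ ?_ ?_
        · simp only [imgExp_eq_iff, imgExp_zero, imgExp_one, expo_zero, expo_one, expo_two,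
            expo_three]
          constructor <;> ring
        · simp only [degree_fin_four, expo_zero, expo_one, expo_two, expo_three]
          lia
        · rw [monomial_expo, monomial_expo]
          have : (MvPowerSeries.X 0 ^ 2 - MvPowerSeries.X 2 ^ (2 * n + 1) * MvPowerSeries.X 3 :
              MvPowerSeries (Fin 4) k) ∈ p k n := Ideal.subset_span (by simp)
          convert Ideal.mul_mem_left _ (MvPowerSeries.X 0 ^ a * MvPowerSeries.X 1 ^ b *
            MvPowerSeries.X 2 ^ c * MvPowerSeries.X 3 ^ e) this using 1
          ring
      by_cases hb : 2 ≤ b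
      · obtain ⟨b, rfl⟩ := Nat.exists_eq_add_of_le hb
        refine step a b (c + 1) (e + (2 * n + 1)) (by lia) ?_ ?_ ?_
        · simp only [imgExp_eq_iff, imgExp_zero, imgExp_one, expo_zero, expo_one, expo_two,
            expo_three]
          constructor <;> ring
        · simp only [degree_fin_four, expo_zero, expo_one, expo_two, expo_three]
          lia
        · rw [monomial_expo, monomial_expo]
          have : (MvPowerSeries.X 1 ^ 2 - MvPowerSeries.X 2 * MvPowerSeries.X 3 ^ (2 * n + 1) :
              MvPowerSeries (Fin 4) k) ∈ p k n := Ideal.subset_span (by simp)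
          convert Ideal.mul_mem_left _ (MvPowerSeries.X 0 ^ a * MvPowerSeries.X 1 ^ b *
            MvPowerSeries.X 2 ^ c * MvPowerSeries.X 3 ^ e) this using 1
          ring
      by_cases hab : a = 1 ∧ b = 1
      · obtain ⟨rfl, rfl⟩ := hab
        refine step 0 0 (c + (n + 1)) (e + (n + 1)) (by lia) ?_ ?_ ?_
        · simp only [imgExp_eq_iff, imgExp_zero, imgExp_one, expo_zero, expo_one, expo_two,
            expo_three]
          constructor <;> ring
        · simp only [degree_fin_four, expo_zero, expo_one, expo_two, expo_three]
          lia
        · rw [monomial_expo, monomial_expo]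
          have : (MvPowerSeries.X 0 * MvPowerSeries.X 1 - MvPowerSeries.X 2 ^ (n + 1) *
              MvPowerSeries.X 3 ^ (n + 1) : MvPowerSeries (Fin 4) k) ∈ p k n :=
            Ideal.subset_span (by simp)
          convert Ideal.mul_mem_left _ (MvPowerSeries.X 2 ^ c * MvPowerSeries.X 3 ^ e) this using 1
          ring
      by_cases hc : a = 0 ∧ b = 1 ∧ n ≤ c
      · obtain ⟨rfl, rfl, hc⟩ := hc
        obtain ⟨c, rfl⟩ := Nat.exists_eq_add_of_le hc
        refine step 1 0 c (e + n) (by lia) ?_ ?_ ?_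
        · simp only [imgExp_eq_iff, imgExp_zero, imgExp_one, expo_zero, expo_one, expo_two,
            expo_three]
          constructor <;> ring
        · simp only [degree_fin_four, expo_zero, expo_one, expo_two, expo_three]
          lia
        · rw [monomial_expo, monomial_expo]
          have : (MvPowerSeries.X 1 * MvPowerSeries.X 2 ^ n - MvPowerSeries.X 0 *
              MvPowerSeries.X 3 ^ n : MvPowerSeries (Fin 4) k) ∈ p k n :=
            Ideal.subset_span (by simp)
          convert Ideal.mul_mem_left _ (MvPowerSeries.X 2 ^ c * MvPowerSeries.X 3 ^ e) this using 1
          ring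
      refine ⟨expo a b c e, ?_, rfl, le_rfl, by simp⟩
      simp only [IsNormal, expo_zero, expo_one, expo_two]
      lia
  rw [← expo_eta d]
  exact key _ _ _ _ _ rfl

end monomials

variable {k : Type*} [Field k] {n : ℕ}

theorem coeff_prod_param (d : Fin 4 →₀ ℕ) :
    (d.prod fun s e => param k n s ^ e) = MvPowerSeries.monomial (imgExp n d) 1 := by
  rw [Finsupp.prod_fintype _ _ (by simp), Fin.prod_univ_four]
  simp only [param, Matrix.cons_val, MvPowerSeries.X, MvPowerSeries.monomial_pow,
    MvPowerSeries.monomial_mul_monomial, one_pow, mul_one]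
  congr 2
  apply ext_fin_two <;> simp <;> ring

theorem phi_monomial (d : Fin 4 →₀ ℕ) (c : k) :
    phi k n (MvPowerSeries.monomial d c) = MvPowerSeries.monomial (imgExp n d) c := by
  rw [phi, MvPowerSeries.substAlgHom_monomial, coeff_prod_param, ← Algebra.smul_def, ← map_smul,
    smul_eq_mul, mul_one]

/-- The fibres of `imgExp n` are finite, so the `finsum` is a genuine sum and not its default value.
-/
theorem coeff_phi (μ : Fin 2 →₀ ℕ) (f : MvPowerSeries (Fin 4) k) :
    MvPowerSeries.coeff μ (phi k n f) =
      ∑ᶠ d, if imgExp n d = μ then MvPowerSeries.coeff d f else 0 := by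
  classical
  rw [phi, MvPowerSeries.substAlgHom_apply, MvPowerSeries.coeff_subst (hasSubst_param k n)]
  refine finsum_congr fun d => ?_
  rw [coeff_prod_param, MvPowerSeries.coeff_monomial]
  simp [eq_comm]

theorem exists_of_coeff_phi_ne_zero {μ : Fin 2 →₀ ℕ} {f : MvPowerSeries (Fin 4) k}
    (h : MvPowerSeries.coeff μ (phi k n f) ≠ 0) :
    ∃ d, imgExp n d = μ ∧ MvPowerSeries.coeff d f ≠ 0 := by
  by_contra! hc
  refine h ?_
  rw [coeff_phi]
  refine finsum_eq_zero_of_forall_eq_zero fun d => ?_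
  split_ifs with hd
  · exact hc d hd
  · rfl

/-- Each fibre of `imgExp n` contains at most one normal exponent, so the sum for the coefficient
collapses. -/
theorem coeff_imgExp_phi {f : MvPowerSeries (Fin 4) k}
    (hf : ∀ d, ¬ IsNormal n d → MvPowerSeries.coeff d f = 0) {d : Fin 4 →₀ ℕ} (hd : IsNormal n d) :
    MvPowerSeries.coeff (imgExp n d) (phi k n f) = MvPowerSeries.coeff d f := by
  rw [coeff_phi, finsum_eq_single _ d]
  · simp
  · intro d' hne
    split_ifs with h
    · by_cases hd' : IsNormal n d'
      · exact absurd (hd'.eq_of_imgExp_eq hd h) hne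
      · exact hf d' hd'
    · rfl

variable (k n) in
/-- The linear section of `φ_n` onto the power series supported on normal monomials. -/
def normalLift : MvPowerSeries (Fin 2) k →ₗ[k] MvPowerSeries (Fin 4) k where
  toFun F := MvPowerSeries.ofCoeff fun d =>
    if IsNormal n d then MvPowerSeries.coeff (imgExp n d) F else 0
  map_add' F G := by
    ext d
    simp only [MvPowerSeries.coeff_ofCoeff, map_add]
    split_ifs <;> simp
  map_smul' c F := by
    ext d
    simp only [MvPowerSeries.coeff_ofCoeff, map_smul, RingHom.id_apply]
    split_ifs <;> simp

theorem coeff_normalLift (F : MvPowerSeries (Fin 2) k) (d : Fin 4 →₀ ℕ) :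
    MvPowerSeries.coeff d (normalLift k n F) =
      if IsNormal n d then MvPowerSeries.coeff (imgExp n d) F else 0 := rfl

theorem phi_normalLift {F : MvPowerSeries (Fin 2) k}
    (hF : ∀ μ, MvPowerSeries.coeff μ F ≠ 0 → ∃ d, IsNormal n d ∧ imgExp n d = μ) :
    phi k n (normalLift k n F) = F := by
  have hs : ∀ d, ¬ IsNormal n d → MvPowerSeries.coeff d (normalLift k n F) = 0 := fun d hd => by
    rw [coeff_normalLift, if_neg hd]
  ext μ
  by_cases h : ∃ d, IsNormal n d ∧ imgExp n d = μ
  · obtain ⟨d, hd, rfl⟩ := h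
    rw [coeff_imgExp_phi hs hd, coeff_normalLift, if_pos hd]
  · rw [not_imp_comm.1 (hF μ) h]
    by_contra hne
    obtain ⟨d, h1, h2⟩ := exists_of_coeff_phi_ne_zero hne
    exact h ⟨d, not_imp_comm.1 (hs d) h2, h1⟩

variable (k n) in
/-- The normal form of a power series modulo `𝔭_n`. -/
def normalForm : MvPowerSeries (Fin 4) k →ₗ[k] MvPowerSeries (Fin 4) k :=
  normalLift k n ∘ₗ (phi k n).toLinearMap

theorem coeff_normalForm (f : MvPowerSeries (Fin 4) k) (d : Fin 4 →₀ ℕ) :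
    MvPowerSeries.coeff d (normalForm k n f) =
      if IsNormal n d then MvPowerSeries.coeff (imgExp n d) (phi k n f) else 0 := rfl

theorem normalForm_eq_self {f : MvPowerSeries (Fin 4) k}
    (hf : ∀ d, ¬ IsNormal n d → MvPowerSeries.coeff d f = 0) : normalForm k n f = f := by
  ext d
  rw [coeff_normalForm]
  split_ifs with h
  · exact coeff_imgExp_phi hf h
  · exact (hf d h).symm

/-- Rewriting never lowers the degree of a monomial. This is what makes the `𝔪`-adic filtration of
`R_n` visible on normal forms. -/
theorem normalForm_mem_pow {f : MvPowerSeries (Fin 4) k} {j : ℕ}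
    (hf : f ∈ (Ideal.span (Set.range MvPowerSeries.X)) ^ j) :
    normalForm k n f ∈ (Ideal.span (Set.range MvPowerSeries.X)) ^ j := by
  rw [MvPowerSeries.mem_span_X_pow_iff] at hf ⊢
  intro d hd
  rw [coeff_normalForm]
  split_ifs with h
  · by_contra hne
    obtain ⟨e, h1, h2⟩ := exists_of_coeff_phi_ne_zero hne
    obtain ⟨e', g1, g2, g3, -⟩ := exists_isNormal_sub_mem (k := k) n e
    obtain rfl := g1.eq_of_imgExp_eq h (g2.trans h1)
    exact h2 (hf e (by lia))
  · rfl

theorem sub_normalForm_monomial_mem (d : Fin 4 →₀ ℕ) (c : k) :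
    MvPowerSeries.monomial d c - normalForm k n (MvPowerSeries.monomial d c) ∈ p k n := by
  obtain ⟨d', g1, g2, -, g4⟩ := exists_isNormal_sub_mem (k := k) n d
  have : normalForm k n (MvPowerSeries.monomial d c) = MvPowerSeries.monomial d' c := by
    rw [← normalForm_eq_self (n := n) (f := MvPowerSeries.monomial d' c), normalForm]
    · simp only [LinearMap.comp_apply, AlgHom.toLinearMap_apply, phi_monomial, g2]
    · classical
      intro e he
      rw [MvPowerSeries.coeff_monomial, if_neg]
      rintro rfl
      exact he g1
  rw [this]
  have := Ideal.mul_mem_left _ (algebraMap k _ c) g4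
  rwa [mul_sub, ← Algebra.smul_def, ← Algebra.smul_def, ← map_smul, ← map_smul, smul_eq_mul,
    mul_one] at this

theorem sub_truncTotal_mem_pow (f : MvPowerSeries (Fin 4) k) (j : ℕ) :
    f - (MvPowerSeries.truncTotal j f : MvPolynomial (Fin 4) k) ∈
      (Ideal.span (Set.range MvPowerSeries.X)) ^ j := by
  rw [MvPowerSeries.mem_span_X_pow_iff]
  intro d hd
  rw [map_sub, MvPolynomial.coeff_coe, MvPowerSeries.coeff_truncTotal _ hd, sub_self]

theorem sub_normalForm_coe_mem (g : MvPolynomial (Fin 4) k) :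
    (g : MvPowerSeries (Fin 4) k) - normalForm k n g ∈ p k n := by
  induction g using MvPolynomial.induction_on' with
  | monomial d c =>
    rw [MvPolynomial.coe_monomial]
    exact sub_normalForm_monomial_mem d c
  | add f g hf hg =>
    rw [MvPolynomial.coe_add, map_add, add_sub_add_comm]
    exact Ideal.add_mem _ hf hg

/-- A power series is congruent to its normal form modulo `𝔭_n`. -/
theorem sub_normalForm_mem (f : MvPowerSeries (Fin 4) k) : f - normalForm k n f ∈ p k n := by
  -- The polynomial case handles the truncation of `f`. The remainder and its normal form both have
  -- order at least `j`, and `𝔭_n` is closed.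
  refine MvPowerSeries.mem_of_forall_mem_sup_pow fun j => ?_
  have h1 := sub_truncTotal_mem_pow f j
  have h2 := normalForm_mem_pow (n := n) h1
  have h3 := sub_normalForm_coe_mem (n := n) (MvPowerSeries.truncTotal j f)
  rw [map_sub] at h2
  have := Ideal.add_mem _ (Ideal.mem_sup_left h3) (Ideal.mem_sup_right (Ideal.sub_mem _ h1 h2))
  convert this using 1
  ring

@[simp] theorem phi_X (i : Fin 4) : phi k n (MvPowerSeries.X i) = param k n i :=
  MvPowerSeries.substAlgHom_X _ _

/-- `𝔭_n` is the kernel of `φ_n`. -/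
theorem ker_phi : RingHom.ker (phi k n) = p k n := by
  apply le_antisymm
  · intro f hf
    rw [RingHom.mem_ker] at hf
    have := sub_normalForm_mem (n := n) f
    rwa [normalForm, LinearMap.comp_apply, AlgHom.toLinearMap_apply, hf, map_zero,
      sub_zero] at this
  · rw [p, Ideal.span_le]
    intro f hf
    simp only [Set.mem_insert_iff, Set.mem_singleton_iff] at hf
    rw [SetLike.mem_coe, RingHom.mem_ker]
    rcases hf with rfl | rfl | rfl | rfl <;>
      simp only [map_sub, map_mul, map_pow, phi_X, param, Matrix.cons_val] <;> ring

instance : IsDomain (MvPowerSeries (Fin 2) k) := NoZeroDivisors.to_isDomain _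

instance isPrime_p : (p k n).IsPrime := by
  rw [← ker_phi]
  exact RingHom.ker_isPrime _

/-- The isomorphism of `R_n` with `k[[s t^{2n+1}, s^{2n+1} t, t², s²]]`. -/
theorem exists_algEquiv_paramSubalgebra : ∃ e : R k n ≃ₐ[k] paramSubalgebra k n,
    ∀ f : MvPowerSeries (Fin 4) k,
      (e (Ideal.Quotient.mk (p k n) f) : MvPowerSeries (Fin 2) k) = phi k n f :=
  ⟨(Ideal.quotientEquivAlgOfEq k (by
      ext f
      rw [← ker_phi, RingHom.mem_ker, RingHom.mem_ker, Subtype.ext_iff]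
      rfl)).trans
    (Ideal.quotientKerAlgEquivOfSurjective (f := (phi k n).rangeRestrict)
      (phi k n).rangeRestrict_surjective), fun f => rfl⟩

end AbhyankarFamily

/-! ### Hilbert functions and lengths computed from linear maps on the ring. -/

section GradedPiece

variable {A : Type*} [CommRing A]

/-- The space `I^j / I^{j+1}`. -/
abbrev GradedPiece (I : Ideal A) (j : ℕ) : Type _ := ↥(I ^ j) ⧸ (I • ⊤ : Submodule A ↥(I ^ j))

theorem mem_smul_top_iff (I : Ideal A) (j : ℕ) (x : ↥(I ^ j)) :
    x ∈ (I • ⊤ : Submodule A ↥(I ^ j)) ↔ (x : A) ∈ I ^ (j + 1) := by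
  rw [Submodule.mem_smul_top_iff, smul_eq_mul, pow_succ']

/-- A linear map on `A` whose restriction to `I^j` is surjective with kernel `I^{j+1}` identifies
`I^j / I^{j+1}`. -/
def gradedPieceEquiv {k V : Type*} [Field k] [Algebra k A] [AddCommGroup V] [Module k V]
    (I : Ideal A) (j : ℕ) (L : A →ₗ[k] V) (hker : ∀ x ∈ I ^ j, L x = 0 ↔ x ∈ I ^ (j + 1))
    (hsurj : ∀ v, ∃ x ∈ I ^ j, L x = v) : GradedPiece I j ≃ₗ[k] V :=
  (Submodule.Quotient.restrictScalarsEquiv k _).symm ≪≫ₗ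
  (Submodule.quotEquivOfEq _ (LinearMap.ker (L ∘ₗ (I ^ j).subtype.restrictScalars k)) (by
    ext x
    rw [Submodule.restrictScalars_mem, mem_smul_top_iff, LinearMap.mem_ker, ← hker x x.2]
    rfl)) ≪≫ₗ
  ((L ∘ₗ (I ^ j).subtype.restrictScalars k).quotKerEquivOfSurjective fun v => by
    obtain ⟨x, hx, rfl⟩ := hsurj v
    exact ⟨⟨x, hx⟩, rfl⟩)

instance {k : Type*} [Field k] [Algebra k A] (I : Ideal A) (j : ℕ) :
    IsScalarTower k (A ⧸ I) (GradedPiece I j) where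
  smul_assoc a x y := by
    obtain ⟨r, rfl⟩ := Ideal.Quotient.mk_surjective x
    change (a • r) • y = a • r • y
    exact smul_assoc _ _ _

/-- The module is killed by `I`, and both `k` and `A` surject onto `A ⧸ I`, so its submodules over
the three rings coincide. -/
theorem length_gradedPiece_eq {k : Type*} [Field k] [Algebra k A] (I : Ideal A) (j : ℕ)
    (h : Function.Surjective (algebraMap k (A ⧸ I))) [Module.Finite k (GradedPiece I j)] :
    Module.length A (GradedPiece I j) = Module.finrank k (GradedPiece I j) := by
  rw [← Module.length_eq_finrank, Module.length_eq_of_surjective (S := k) (R := A ⧸ I) h,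
    Module.length_eq_of_surjective (S := A) (R := A ⧸ I) Ideal.Quotient.mk_surjective]

theorem hilbertFunction_eq_finrank {k : Type*} [Field k] [Algebra k A] [IsLocalRing A] (j : ℕ)
    (h : Function.Surjective (algebraMap k (A ⧸ maximalIdeal A))) :
    hilbertFunction A j = Module.finrank k (GradedPiece (maximalIdeal A) j) := by
  let _ : Field (A ⧸ maximalIdeal A) := Ideal.Quotient.field _
  have h1 := Module.finrank_mul_finrank k (A ⧸ maximalIdeal A) (GradedPiece (maximalIdeal A) j)
  have h2 : Module.finrank k (A ⧸ maximalIdeal A) = 1 := by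
    rw [← (LinearEquiv.ofBijective (Algebra.linearMap k (A ⧸ maximalIdeal A))
      ⟨(algebraMap k (A ⧸ maximalIdeal A)).injective, h⟩).finrank_eq, Module.finrank_self]
  rw [h2, one_mul] at h1
  exact h1

/-- Additivity of length on `0 → I^j/I^{j+1} → A/I^{j+1} → A/I^j → 0`. -/
theorem length_quotient_pow_succ (I : Ideal A) (j : ℕ) :
    Module.length A (A ⧸ I ^ (j + 1)) =
      Module.length A (GradedPiece I j) + Module.length A (A ⧸ I ^ j) := by
  have hle : (I • ⊤ : Submodule A ↥(I ^ j)) ≤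
      LinearMap.ker ((Submodule.mkQ (I ^ (j + 1))) ∘ₗ (I ^ j).subtype) := by
    intro x hx
    rw [mem_smul_top_iff] at hx
    rw [LinearMap.mem_ker, LinearMap.comp_apply, Submodule.mkQ_apply]
    exact (Submodule.Quotient.mk_eq_zero _).2 hx
  refine Module.length_eq_add_of_exact (Submodule.liftQ _ _ hle)
    (Submodule.factor (Ideal.pow_le_pow_right (Nat.le_succ j))) ?_
    (Submodule.factor_surjective _) ?_
  · rw [← LinearMap.ker_eq_bot, Submodule.ker_liftQ_eq_bot]
    intro x hx
    rw [LinearMap.mem_ker, LinearMap.comp_apply, Submodule.mkQ_apply,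
      Submodule.Quotient.mk_eq_zero] at hx
    exact (mem_smul_top_iff I j x).2 hx
  · intro y
    obtain ⟨a, rfl⟩ := Submodule.Quotient.mk_surjective _ y
    rw [Set.mem_range]
    constructor
    · intro h
      have ha : a ∈ I ^ j := (Submodule.Quotient.mk_eq_zero _).1 h
      exact ⟨Submodule.Quotient.mk ⟨a, ha⟩, rfl⟩
    · rintro ⟨x, hx⟩
      obtain ⟨x, rfl⟩ := Submodule.Quotient.mk_surjective _ x
      rw [← hx]
      exact (Submodule.Quotient.mk_eq_zero _).2 x.2

theorem algebraMap_quotient_surjective {k : Type*} [Field k] [Algebra k A] {I : Ideal A}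
    (h : ∀ r : A, ∃ c : k, r - algebraMap k A c ∈ I) :
    Function.Surjective (algebraMap k (A ⧸ I)) := by
  intro x
  obtain ⟨r, rfl⟩ := Ideal.Quotient.mk_surjective x
  obtain ⟨c, hc⟩ := h r
  exact ⟨c, (Ideal.Quotient.eq.2 hc).symm⟩

theorem hilbertFunction_eq_of_linearMap {k V : Type*} [Field k] [Algebra k A] [AddCommGroup V]
    [Module k V] [IsLocalRing A] (h : ∀ r : A, ∃ c : k, r - algebraMap k A c ∈ maximalIdeal A)
    (j : ℕ) (L : A →ₗ[k] V)
    (hker : ∀ x ∈ maximalIdeal A ^ j, L x = 0 ↔ x ∈ maximalIdeal A ^ (j + 1))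
    (hsurj : ∀ v, ∃ x ∈ maximalIdeal A ^ j, L x = v) :
    hilbertFunction A j = Module.finrank k V := by
  rw [hilbertFunction_eq_finrank j (algebraMap_quotient_surjective h),
    (gradedPieceEquiv _ j L hker hsurj).finrank_eq]

theorem length_quotient_pow_succ_of_linearMap {k V : Type*} [Field k] [Algebra k A]
    [AddCommGroup V] [Module k V] [Module.Finite k V] (I : Ideal A)
    (h : ∀ r : A, ∃ c : k, r - algebraMap k A c ∈ I) (j : ℕ) (L : A →ₗ[k] V)
    (hker : ∀ x ∈ I ^ j, L x = 0 ↔ x ∈ I ^ (j + 1)) (hsurj : ∀ v, ∃ x ∈ I ^ j, L x = v) :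
    Module.length A (A ⧸ I ^ (j + 1)) = Module.finrank k V + Module.length A (A ⧸ I ^ j) := by
  have := Module.Finite.equiv (gradedPieceEquiv _ j L hker hsurj).symm
  rw [length_quotient_pow_succ, length_gradedPiece_eq _ _ (algebraMap_quotient_surjective h),
    (gradedPieceEquiv _ j L hker hsurj).finrank_eq]

theorem hilbertFunction_one [IsLocalRing A] [IsNoetherianRing A] :
    hilbertFunction A 1 = (maximalIdeal A).spanFinrank := by
  -- The ideal `𝔪 ^ 1` occurs inside a dependent type, so it is generalized before being identified
  -- with `𝔪`.
  have : ∀ J : Ideal A, J = maximalIdeal A →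
      Module.finrank (A ⧸ maximalIdeal A) (↥J ⧸ (maximalIdeal A • ⊤ : Submodule A ↥J)) =
        Module.finrank (ResidueField A) (CotangentSpace A) := by
    rintro _ rfl
    rfl
  rw [IsLocalRing.spanFinrank_maximalIdeal_eq_finrank_cotangentSpace]
  exact this _ (pow_one _)

theorem length_quotient_pow_zero (I : Ideal A) : Module.length A (A ⧸ I ^ 0) = 0 := by
  have : Subsingleton (A ⧸ I ^ 0) := by
    rw [pow_zero, Ideal.one_eq_top]
    exact Ideal.Quotient.subsingleton_iff.2 rfl
  exact Module.length_eq_zero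

end GradedPiece

/-! ### The Hilbert function, Hilbert series and Hilbert polynomial of `R_n`. -/

namespace AbhyankarFamily

variable {k : Type*} [Field k] {n : ℕ}

variable (k n) in
/-- The `k`-module structure of `R_n` as an algebra. -/
abbrev moduleR : Module k (R k n) := Algebra.toModule

attribute [local instance] moduleR

variable (k n) in
/-- The embedding of `R_n` into `k[[s, t]]` induced by `φ_n`. -/
def phiBar : R k n →ₐ[k] MvPowerSeries (Fin 2) k :=
  Ideal.Quotient.liftₐ (p k n) (phi k n) fun f hf => by
    rwa [← ker_phi, RingHom.mem_ker] at hf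

@[simp] theorem phiBar_mk (f : MvPowerSeries (Fin 4) k) :
    phiBar k n (Ideal.Quotient.mk (p k n) f) = phi k n f := rfl

theorem phiBar_injective : Function.Injective (phiBar k n) := by
  rw [injective_iff_map_eq_zero]
  intro r hr
  obtain ⟨f, rfl⟩ := Ideal.Quotient.mk_surjective r
  rw [phiBar_mk, ← RingHom.mem_ker, ker_phi] at hr
  exact Ideal.Quotient.eq_zero_iff_mem.2 hr

variable (k n) in
/-- The normal form of an element of `R_n`. -/
def nf : R k n →ₗ[k] MvPowerSeries (Fin 4) k := normalLift k n ∘ₗ (phiBar k n).toLinearMap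

@[simp] theorem nf_mk (f : MvPowerSeries (Fin 4) k) :
    nf k n (Ideal.Quotient.mk (p k n) f) = normalForm k n f := rfl

theorem coeff_nf_of_not_isNormal (r : R k n) {d : Fin 4 →₀ ℕ} (hd : ¬ IsNormal n d) :
    MvPowerSeries.coeff d (nf k n r) = 0 := by
  rw [nf, LinearMap.comp_apply, coeff_normalLift, if_neg hd]

theorem mk_nf (r : R k n) : Ideal.Quotient.mk (p k n) (nf k n r) = r := by
  obtain ⟨f, rfl⟩ := Ideal.Quotient.mk_surjective r
  rw [nf_mk, eq_comm, Ideal.Quotient.eq]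
  exact sub_normalForm_mem f

theorem maximalIdeal_R : maximalIdeal (R k n) =
    (Ideal.span (Set.range MvPowerSeries.X)).map (Ideal.Quotient.mk (p k n)) := by
  rw [← MvPowerSeries.maximalIdeal_eq_span_X,
    IsLocalRing.map_maximalIdeal_of_surjective _ Ideal.Quotient.mk_surjective]

theorem mk_mem_maximalIdeal_pow {f : MvPowerSeries (Fin 4) k} {j : ℕ}
    (hf : f ∈ (Ideal.span (Set.range MvPowerSeries.X)) ^ j) :
    Ideal.Quotient.mk (p k n) f ∈ maximalIdeal (R k n) ^ j := by
  rw [maximalIdeal_R, ← Ideal.map_pow]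
  exact Ideal.mem_map_of_mem _ hf

/-- A lift of order at least `j` has a normal form of order at least `j`, and the normal form is
itself a lift. -/
theorem mem_maximalIdeal_pow_iff {r : R k n} {j : ℕ} : r ∈ maximalIdeal (R k n) ^ j ↔
    ∀ d : Fin 4 →₀ ℕ, d.degree < j → MvPowerSeries.coeff d (nf k n r) = 0 := by
  rw [← MvPowerSeries.mem_span_X_pow_iff]
  constructor
  · intro h
    rw [maximalIdeal_R, ← Ideal.map_pow,
      Ideal.mem_map_iff_of_surjective _ Ideal.Quotient.mk_surjective] at h
    obtain ⟨f, hf, rfl⟩ := h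
    exact normalForm_mem_pow hf
  · intro h
    rw [← mk_nf r]
    exact mk_mem_maximalIdeal_pow h

theorem exists_sub_algebraMap_mem (r : R k n) :
    ∃ c : k, r - algebraMap k (R k n) c ∈ maximalIdeal (R k n) := by
  classical
  obtain ⟨f, rfl⟩ := Ideal.Quotient.mk_surjective r
  refine ⟨MvPowerSeries.constantCoeff f, ?_⟩
  change Ideal.Quotient.mk _ f - Ideal.Quotient.mk _ (MvPowerSeries.C _) ∈ _
  rw [← map_sub, ← pow_one (maximalIdeal _)]
  apply mk_mem_maximalIdeal_pow
  rw [MvPowerSeries.mem_span_X_pow_iff]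
  intro d hd
  have : d = 0 := by rwa [Nat.lt_one_iff, Finsupp.degree_eq_zero_iff] at hd
  simp [this]

/-- The normal exponents of degree `j`. -/
def normalExps (n j : ℕ) : Finset (Fin 4 →₀ ℕ) :=
  (Finset.range (j + 1)).image (fun c => expo 0 0 c (j - c)) ∪
    ((Finset.range j).image (fun c => expo 1 0 c (j - 1 - c)) ∪
      (Finset.range (min j n)).image (fun c => expo 0 1 c (j - 1 - c)))

theorem mem_normalExps {n j : ℕ} {d : Fin 4 →₀ ℕ} :
    d ∈ normalExps n j ↔ IsNormal n d ∧ d.degree = j := by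
  simp only [normalExps, Finset.mem_union, Finset.mem_image, Finset.mem_range]
  constructor
  · rintro (⟨c, hc, rfl⟩ | ⟨c, hc, rfl⟩ | ⟨c, hc, rfl⟩) <;>
    · simp only [IsNormal, degree_fin_four, expo_zero, expo_one, expo_two, expo_three]
      lia
  · rw [degree_fin_four]
    rintro ⟨⟨h1, h2⟩ | ⟨h1, h2, h3⟩, rfl⟩
    · rcases Nat.le_one_iff_eq_zero_or_eq_one.1 h2 with h0 | h0
      · exact Or.inl ⟨d 2, by lia, ext_fin_four (by simp [*]) (by simp [*]) (by simp)
          (by simp [*])⟩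
      · exact Or.inr (Or.inl ⟨d 2, by lia, ext_fin_four (by simp [*]) (by simp [*]) (by simp)
          (by simp [*]; lia)⟩)
    · exact Or.inr (Or.inr ⟨d 2, by lia, ext_fin_four (by simp [*]) (by simp [*]) (by simp)
          (by simp [*]; lia)⟩)

/-- There are `j + 1` monomials in `z, w` alone, `j` divisible by `x`, and `min j n` divisible by
`y`. -/
theorem card_normalExps (n j : ℕ) : (normalExps n j).card = 2 * j + 1 + min j n := by
  have hinj : ∀ a b (g : ℕ → ℕ), Function.Injective fun c => expo a b c (g c) :=
    fun a b g c c' h => DFunLike.congr_fun h 2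
  rw [normalExps, Finset.card_union_of_disjoint, Finset.card_union_of_disjoint,
    Finset.card_image_of_injective _ (hinj _ _ _), Finset.card_image_of_injective _ (hinj _ _ _),
    Finset.card_image_of_injective _ (hinj _ _ _), Finset.card_range, Finset.card_range,
    Finset.card_range]
  · ring
  · rw [Finset.disjoint_left]
    intro d h1 h2
    rw [Finset.mem_image] at h1 h2
    obtain ⟨c, -, rfl⟩ := h1
    obtain ⟨c', -, h⟩ := h2
    simpa using DFunLike.congr_fun h 0
  · rw [Finset.disjoint_left]
    intro d h1 h2
    rw [Finset.mem_union, Finset.mem_image, Finset.mem_image] at h2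
    rw [Finset.mem_image] at h1
    obtain ⟨c, -, rfl⟩ := h1
    obtain ⟨c', -, h⟩ | ⟨c', -, h⟩ := h2
    · simpa using DFunLike.congr_fun h 0
    · simpa using DFunLike.congr_fun h 1

variable (k n) in
/-- The coefficients of the normal form of an element at the normal exponents of degree `j`. -/
def symbol (j : ℕ) : R k n →ₗ[k] (normalExps n j → k) :=
  LinearMap.pi fun d => MvPowerSeries.coeff d.1 ∘ₗ nf k n

theorem symbol_apply (j : ℕ) (r : R k n) (d : normalExps n j) :
    symbol k n j r d = MvPowerSeries.coeff d.1 (nf k n r) := rfl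

theorem symbol_eq_zero_iff {j : ℕ} {r : R k n} (hr : r ∈ maximalIdeal (R k n) ^ j) :
    symbol k n j r = 0 ↔ r ∈ maximalIdeal (R k n) ^ (j + 1) := by
  rw [mem_maximalIdeal_pow_iff] at hr ⊢
  constructor
  · intro h d hd
    rcases Nat.lt_succ_iff_lt_or_eq.1 hd with hlt | heq
    · exact hr d hlt
    · by_cases hnd : IsNormal n d
      · exact congrFun h ⟨d, mem_normalExps.2 ⟨hnd, heq⟩⟩
      · exact coeff_nf_of_not_isNormal r hnd
  · intro h
    ext d
    rw [symbol_apply]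
    exact h d (by rw [(mem_normalExps.1 d.2).2]; lia)

theorem coeff_sum_monomial {j : ℕ} (v : normalExps n j → k) (d : Fin 4 →₀ ℕ) :
    MvPolynomial.coeff d (∑ e, MvPolynomial.monomial e.1 (v e)) =
      if h : d ∈ normalExps n j then v ⟨d, h⟩ else 0 := by
  classical
  rw [MvPolynomial.coeff_sum]
  simp only [MvPolynomial.coeff_monomial]
  split_ifs with h
  · rw [Finset.sum_eq_single ⟨d, h⟩]
    · simp
    · intro e _ he
      rw [if_neg fun h' => he (Subtype.ext h')]
    · simp
  · refine Finset.sum_eq_zero fun e _ => if_neg ?_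
    rintro rfl
    exact h e.2

theorem symbol_sum_monomial {j : ℕ} (v : normalExps n j → k) :
    symbol k n j (Ideal.Quotient.mk (p k n)
      (∑ e, MvPolynomial.monomial e.1 (v e) : MvPolynomial (Fin 4) k)) = v := by
  ext d
  rw [symbol_apply, nf_mk, normalForm_eq_self, MvPolynomial.coeff_coe, coeff_sum_monomial,
    dif_pos d.2]
  intro e he
  rw [MvPolynomial.coeff_coe, coeff_sum_monomial, dif_neg fun h => he (mem_normalExps.1 h).1]

theorem mk_sum_monomial_mem {j : ℕ} (v : normalExps n j → k) :
    Ideal.Quotient.mk (p k n) (∑ e, MvPolynomial.monomial e.1 (v e) : MvPolynomial (Fin 4) k) ∈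
      maximalIdeal (R k n) ^ j := by
  apply mk_mem_maximalIdeal_pow
  rw [MvPowerSeries.mem_span_X_pow_iff]
  intro d hd
  rw [MvPolynomial.coeff_coe, coeff_sum_monomial, dif_neg]
  intro h
  rw [(mem_normalExps.1 h).2] at hd
  exact lt_irrefl _ hd

/-- The Hilbert function of `R_n`. -/
theorem hilbertFunction_R (j : ℕ) : hilbertFunction (R k n) j = 2 * j + 1 + min j n := by
  rw [hilbertFunction_eq_of_linearMap exists_sub_algebraMap_mem j (symbol k n j)
    (fun _ hx => symbol_eq_zero_iff hx)
    (fun v => ⟨_, mk_sum_monomial_mem v, symbol_sum_monomial v⟩),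
    Module.finrank_fintype_fun_eq_card, Fintype.card_coe, card_normalExps]

theorem length_R_quotient_pow (j : ℕ) : Module.length (R k n) (R k n ⧸ maximalIdeal (R k n) ^ j) =
    (∑ i ∈ Finset.range j, (2 * i + 1 + min i n) : ℕ) := by
  induction j with
  | zero => exact length_quotient_pow_zero _
  | succ j ih =>
    rw [length_quotient_pow_succ_of_linearMap _ exists_sub_algebraMap_mem j (symbol k n j)
      (fun _ hx => symbol_eq_zero_iff hx)
      (fun v => ⟨_, mk_sum_monomial_mem v, symbol_sum_monomial v⟩), ih,
      Module.finrank_fintype_fun_eq_card, Fintype.card_coe, card_normalExps,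
      Finset.sum_range_succ, add_comm]
    norm_cast

/-- The Hilbert polynomial of `R_n`. -/
def hilbertPoly (n : ℕ) : Polynomial ℚ :=
  (Polynomial.X + 1) * (Polynomial.X + 1 + Polynomial.C (n : ℚ)) -
    Polynomial.C ((n : ℚ) * (n + 1) / 2)

theorem eval_hilbertPoly {n j : ℕ} (hj : n ≤ j) : (hilbertPoly n).eval (j : ℚ) =
    (∑ i ∈ Finset.range (j + 1), (2 * i + 1 + min i n) : ℕ) := by
  -- For `i ≤ n` the summand is `3i + 1`. Beyond that the minimum stays at `n`, and the sum grows as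
  -- the polynomial does.
  have h1 : ∀ m : ℕ, m ≤ n + 1 →
      ((∑ i ∈ Finset.range m, (2 * i + 1 + min i n) : ℕ) : ℚ) = m ^ 2 + m * (m - 1) / 2 := by
    intro m hm
    induction m with
    | zero => simp
    | succ m ih =>
      rw [Finset.sum_range_succ, Nat.cast_add, ih (by lia), min_eq_left (by lia)]
      push_cast
      ring
  induction j, hj using Nat.le_induction with
  | base =>
    rw [h1 _ le_rfl]
    simp only [hilbertPoly, Polynomial.eval_sub, Polynomial.eval_mul, Polynomial.eval_add,
      Polynomial.eval_X, Polynomial.eval_one, Polynomial.eval_C]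
    push_cast
    ring
  | succ j hj ih =>
    rw [Finset.sum_range_succ, Nat.cast_add (∑ i ∈ _, _), ← ih, min_eq_right (by lia)]
    simp only [hilbertPoly, Polynomial.eval_sub, Polynomial.eval_mul, Polynomial.eval_add,
      Polynomial.eval_X, Polynomial.eval_one, Polynomial.eval_C]
    push_cast
    ring

/-- The values at `0` and `-1` differ by `n + 1`. -/
theorem hilbertPoly_injective : Function.Injective hilbertPoly := by
  intro n n' h
  have h0 := congrArg (Polynomial.eval (-1)) h
  have h1 := congrArg (Polynomial.eval 0) h
  simp only [hilbertPoly, Polynomial.eval_sub, Polynomial.eval_mul, Polynomial.eval_add,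
    Polynomial.eval_X, Polynomial.eval_one, Polynomial.eval_C] at h0 h1
  have : (n : ℚ) = n' := by linarith
  exact_mod_cast this

theorem isHilbertPolynomial_R : IsHilbertPolynomial (R k n) (hilbertPoly n) := by
  filter_upwards [Filter.eventually_ge_atTop n] with j hj
  exact ⟨_, length_R_quotient_pow (j + 1), eval_hilbertPoly hj⟩

/-- The numerator of the Hilbert series of `R_n`. -/
def hPoly (n : ℕ) : Polynomial ℤ := 1 + 2 * Polynomial.X - Polynomial.X ^ (n + 1)

/-- Multiplication by `(1 - t)²` takes second differences of `2j + 1 + min(j, n)`. These are `1` and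
`2` in degrees `0` and `1`, and then vanish except for `-1` at `j = n + 1`, where the slope falls
from `3` to `2`. -/
theorem hPoly_eq (hn : 1 ≤ n) : (hPoly n : PowerSeries ℤ) = (1 - PowerSeries.X) ^ 2 *
    PowerSeries.mk (fun j => (hilbertFunction (R k n) j : ℤ)) := by
  simp only [hilbertFunction_R]
  rw [sq, mul_assoc]
  have h2 : (2 : Polynomial ℤ) = Polynomial.C 2 := rfl
  ext j
  rw [sub_mul, map_sub, one_mul, sub_mul, map_sub, one_mul, hPoly, Polynomial.coeff_coe,
    Polynomial.coeff_sub, Polynomial.coeff_add, Polynomial.coeff_one, Polynomial.coeff_X_pow,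
    h2, Polynomial.coeff_C_mul, Polynomial.coeff_X]
  rcases j with _ | _ | j
  · simp
  · simp [PowerSeries.coeff_succ_X_mul]
    lia
  · simp only [PowerSeries.coeff_succ_X_mul, map_sub, PowerSeries.coeff_mk]
    push_cast
    split_ifs <;> lia

/-- This makes the choice in `hilbertCoeff` harmless: any explicit numerator computes the
coefficients. -/
theorem IsHPolynomial.unique {A : Type*} [CommRing A] [IsLocalRing A] {h h' : Polynomial ℤ}
    (H : IsHPolynomial A h) (H' : IsHPolynomial A h') : h = h' := by
  obtain ⟨d, hd, e⟩ := H
  obtain ⟨d', hd', e'⟩ := H'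
  have : d = d' := by
    rw [hd] at hd'
    exact_mod_cast hd'
  subst this
  exact Polynomial.coe_injective ℤ (e.trans e'.symm)

theorem hilbertCoeff_eq {A : Type*} [CommRing A] [IsLocalRing A] {h : Polynomial ℤ}
    (H : IsHPolynomial A h) (i : ℕ) : hilbertCoeff A i = (Polynomial.hasseDeriv i h).eval 1 := by
  have hex : ∃ h, IsHPolynomial A h := ⟨h, H⟩
  rw [hilbertCoeff, dif_pos hex, IsHPolynomial.unique hex.choose_spec H]

theorem isHPolynomial_hPoly (hn : 1 ≤ n) (hdim : ringKrullDim (R k n) = 2) :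
    IsHPolynomial (R k n) (hPoly n) := ⟨2, hdim, hPoly_eq hn⟩

theorem hilbertCoeff_zero_R (hn : 1 ≤ n) (hdim : ringKrullDim (R k n) = 2) :
    hilbertCoeff (R k n) 0 = 2 := by
  rw [hilbertCoeff_eq (isHPolynomial_hPoly hn hdim)]
  simp [hPoly]

theorem hilbertCoeff_one_R (hn : 1 ≤ n) (hdim : ringKrullDim (R k n) = 2) :
    hilbertCoeff (R k n) 1 = 1 - n := by
  rw [hilbertCoeff_eq (isHPolynomial_hPoly hn hdim), Polynomial.hasseDeriv_one]
  simp [hPoly]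
  ring

theorem spanFinrank_maximalIdeal_R (hn : 1 ≤ n) : (maximalIdeal (R k n)).spanFinrank = 4 := by
  rw [← hilbertFunction_one, hilbertFunction_R, min_eq_left hn]

end AbhyankarFamily

/-! ### Completeness, the dimension of `R_n`, and the height of `𝔭_n`. -/

theorem IsPrecomplete.quotient {A : Type*} [CommRing A] (I J : Ideal A) [IsPrecomplete I A] :
    IsPrecomplete (I.map (Ideal.Quotient.mk J)) (A ⧸ J) := by
  rw [isPrecomplete_iff]
  intro f hf
  -- Successive differences are lifted into `I ^ m`, so the partial sums of the lifts form a Cauchy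
  -- sequence in `A` lifting `f`.
  have hstep : ∀ m, ∃ e ∈ I ^ m, Ideal.Quotient.mk J e = f (m + 1) - f m := by
    intro m
    have h := (hf (Nat.le_succ m)).symm
    rw [SModEq.sub_mem, smul_eq_mul, Ideal.mul_top, ← Ideal.map_pow,
      Ideal.mem_map_iff_of_surjective _ Ideal.Quotient.mk_surjective] at h
    exact h
  choose e he hfe using hstep
  obtain ⟨a, ha⟩ := Ideal.Quotient.mk_surjective (f 0)
  have hF : ∀ m, Ideal.Quotient.mk J (a + ∑ i ∈ Finset.range m, e i) = f m := by
    intro m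
    rw [map_add, map_sum, Finset.sum_congr rfl fun i _ => hfe i, Finset.sum_range_sub, ha]
    ring
  obtain ⟨L, hL⟩ := IsPrecomplete.prec (I := I) (M := A) inferInstance
    (f := fun m => a + ∑ i ∈ Finset.range m, e i) (by
      intro m l hml
      rw [SModEq.comm, SModEq.sub_mem, smul_eq_mul, Ideal.mul_top, add_sub_add_left_eq_sub,
        ← Finset.sum_Ico_eq_sub _ hml]
      exact Ideal.sum_mem _ fun i hi =>
        Ideal.pow_le_pow_right (Finset.mem_Ico.1 hi).1 (he i))
  refine ⟨Ideal.Quotient.mk J L, fun m => ?_⟩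
  have h := hL m
  rw [SModEq.sub_mem, smul_eq_mul, Ideal.mul_top] at h ⊢
  rw [← hF m, ← map_sub, ← Ideal.map_pow]
  exact Ideal.mem_map_of_mem _ h

theorem MvPowerSeries.prime_X_zero {k : Type*} [Field k] (m : ℕ) :
    Prime (X 0 : MvPowerSeries (Fin (m + 1)) k) := by
  have := NoZeroDivisors.to_isDomain (MvPowerSeries (Fin m) k)
  rw [← MulEquiv.prime_iff (finSuccEquiv k m).toMulEquiv]
  change Prime (finSuccEquiv k m (X 0))
  rw [finSuccEquiv_X_zero]
  exact PowerSeries.X_prime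

/-- A power series ring in one variable over the principal ideal domain `k[[t]]` is factorial. It is
used to know that `k[[s, t]]` is integrally closed. -/
theorem MvPowerSeries.uniqueFactorizationMonoid_fin_two (k : Type*) [Field k] :
    UniqueFactorizationMonoid (MvPowerSeries (Fin 2) k) := by
  have e : MvPowerSeries Unit k ≃ₐ[k] MvPowerSeries (Fin 1) k :=
    renameEquiv k (Equiv.ofUnique Unit (Fin 1))
  have h0 : IsPrincipalIdealRing (PowerSeries k) := inferInstance
  have h1 : IsPrincipalIdealRing (MvPowerSeries (Fin 1) k) :=
    IsPrincipalIdealRing.of_surjective (R := PowerSeries k) (e : MvPowerSeries Unit k →+* _)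
      e.surjective
  have h2 := NoZeroDivisors.to_isDomain (MvPowerSeries (Fin 1) k)
  exact MulEquiv.uniqueFactorizationMonoid (finSuccEquiv k 1).symm.toMulEquiv inferInstance

theorem MvPowerSeries.X_ne_zero' {σ k : Type*} [Field k] (i : σ) :
    (X i : MvPowerSeries σ k) ≠ 0 := by
  intro h
  have := congrArg (coeff (Finsupp.single i 1)) h
  rw [coeff_index_single_self_X, map_zero] at this
  exact one_ne_zero this

namespace AbhyankarFamily

variable {k : Type*} [Field k] {n : ℕ}

theorem isDomain_R : IsDomain (R k n) := Ideal.Quotient.isDomain (p k n)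

theorem isAdicComplete_R : IsAdicComplete (maximalIdeal (R k n)) (R k n) := by
  have h1 : IsHausdorff (maximalIdeal (R k n)) (R k n) := inferInstance
  have h2 : IsPrecomplete (maximalIdeal (R k n)) (R k n) := by
    rw [maximalIdeal_R]
    exact IsPrecomplete.quotient _ _
  exact { h1, h2 with }

theorem mk_X_mem (i : Fin 4) :
    Ideal.Quotient.mk (p k n) (MvPowerSeries.X i) ∈ maximalIdeal (R k n) := by
  rw [maximalIdeal_R]
  exact Ideal.mem_map_of_mem _ (Ideal.subset_span ⟨i, rfl⟩)

theorem mk_X_ne_zero (i : Fin 4) : Ideal.Quotient.mk (p k n) (MvPowerSeries.X i) ≠ 0 := by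
  rw [Ne, Ideal.Quotient.eq_zero_iff_mem, ← ker_phi, RingHom.mem_ker, phi_X]
  have h : ∀ j : Fin 2, (MvPowerSeries.X j : MvPowerSeries (Fin 2) k) ≠ 0 := fun j =>
    MvPowerSeries.X_ne_zero' j
  fin_cases i <;> simp [param, h]

/-- A prime of `R_n` containing `z` and `w` is the maximal ideal. -/
theorem eq_maximalIdeal_of_mem {P : Ideal (R k n)} [hP : P.IsPrime]
    (hz : Ideal.Quotient.mk (p k n) (MvPowerSeries.X 2) ∈ P)
    (hw : Ideal.Quotient.mk (p k n) (MvPowerSeries.X 3) ∈ P) : P = maximalIdeal (R k n) := by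
  refine le_antisymm (le_maximalIdeal hP.ne_top) ?_
  have hx : Ideal.Quotient.mk (p k n) (MvPowerSeries.X 0) ∈ P := by
    refine hP.mem_of_pow_mem 2 ?_
    have : Ideal.Quotient.mk (p k n) (MvPowerSeries.X 0) ^ 2 =
        Ideal.Quotient.mk (p k n) (MvPowerSeries.X 2 ^ (2 * n + 1)) *
          Ideal.Quotient.mk (p k n) (MvPowerSeries.X 3) := by
      rw [← map_pow, ← map_mul, Ideal.Quotient.eq]
      exact Ideal.subset_span (by simp)
    rw [this]
    exact P.mul_mem_left _ hw
  have hy : Ideal.Quotient.mk (p k n) (MvPowerSeries.X 1) ∈ P := by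
    refine hP.mem_of_pow_mem 2 ?_
    have : Ideal.Quotient.mk (p k n) (MvPowerSeries.X 1) ^ 2 =
        Ideal.Quotient.mk (p k n) (MvPowerSeries.X 2) *
          Ideal.Quotient.mk (p k n) (MvPowerSeries.X 3 ^ (2 * n + 1)) := by
      rw [← map_pow, ← map_mul, Ideal.Quotient.eq]
      exact Ideal.subset_span (by simp)
    rw [this]
    exact P.mul_mem_right _ hz
  rw [maximalIdeal_R, Ideal.map_span, Ideal.span_le]
  rintro _ ⟨_, ⟨i, rfl⟩, rfl⟩
  fin_cases i
  exacts [hx, hy, hz, hw]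

/-- The upper bound is Krull's height theorem, `𝔪` being minimal over `(z, w)`. The lower bound is
the chain `0 < q < 𝔪` with `q` the preimage of `(s)`: it contains `w ↦ s²` but not `z ↦ t²`. -/
theorem height_maximalIdeal_R : (maximalIdeal (R k n)).height = 2 := by
  have := isDomain_R (k := k) (n := n)
  apply le_antisymm
  · have h := Ideal.height_le_card_of_mem_minimalPrimes_span (p := maximalIdeal (R k n))
      (s := {Ideal.Quotient.mk (p k n) (MvPowerSeries.X 2),
        Ideal.Quotient.mk (p k n) (MvPowerSeries.X 3)}) (Set.toFinite _)
      ⟨⟨inferInstance, by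
          rw [Ideal.span_le]
          rintro _ (rfl | rfl)
          exacts [mk_X_mem 2, mk_X_mem 3]⟩, fun q hq _ => by
          have := hq.1
          exact (eq_maximalIdeal_of_mem (hq.2 (Ideal.subset_span (by simp)))
            (hq.2 (Ideal.subset_span (by simp)))).ge⟩
    refine h.trans ?_
    exact_mod_cast Set.ncard_insert_le _ _ |>.trans (by rw [Set.ncard_singleton])
  · have hprime : (Ideal.span {(MvPowerSeries.X 0 : MvPowerSeries (Fin 2) k)}).IsPrime :=
      (Ideal.span_singleton_prime (MvPowerSeries.X_ne_zero' 0)).2 (MvPowerSeries.prime_X_zero 1)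
    set q := (Ideal.span {(MvPowerSeries.X 0 : MvPowerSeries (Fin 2) k)}).comap (phiBar k n)
      with hq
    have hqp : q.IsPrime := Ideal.comap_isPrime _ _
    have h1 : (⊥ : Ideal (R k n)) < q := by
      rw [bot_lt_iff_ne_bot, Submodule.ne_bot_iff]
      refine ⟨Ideal.Quotient.mk (p k n) (MvPowerSeries.X 3), ?_, mk_X_ne_zero 3⟩
      rw [hq, Ideal.mem_comap, phiBar_mk, phi_X, Ideal.mem_span_singleton]
      exact Dvd.intro_left (MvPowerSeries.X 0 ^ 1) (by simp [param]; ring)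
    have h2 : q < maximalIdeal (R k n) := by
      refine lt_of_le_of_ne (le_maximalIdeal hqp.ne_top) fun h => ?_
      have h3 := mk_X_mem (k := k) (n := n) 2
      rw [← h, hq, Ideal.mem_comap, phiBar_mk, phi_X, Ideal.mem_span_singleton,
        MvPowerSeries.X_dvd_iff] at h3
      have h4 := h3 (Finsupp.single 1 2) (by simp)
      simp [param, MvPowerSeries.X_pow_eq] at h4
    have h3 := Ideal.height_add_one_le_of_lt_of_isPrime h1
    have h4 := Ideal.height_add_one_le_of_lt_of_isPrime h2
    rw [Ideal.height_bot, zero_add] at h3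
    calc (2 : ℕ∞) = 1 + 1 := by norm_num
      _ ≤ q.height + 1 := by gcongr
      _ ≤ _ := h4

theorem ringKrullDim_R : ringKrullDim (R k n) = 2 := by
  rw [← IsLocalRing.maximalIdeal_height_eq_ringKrullDim, height_maximalIdeal_R]
  rfl

/-- The lift `x ↦ s t^{2n+1}, y ↦ v, z ↦ t², w ↦ s²` of the parametrization. -/
def paramLift (k : Type*) [Field k] (n : ℕ) : Fin 4 → MvPowerSeries (Fin 3) k :=
  ![MvPowerSeries.X 0 * MvPowerSeries.X 1 ^ (2 * n + 1), MvPowerSeries.X 2, MvPowerSeries.X 1 ^ 2,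
    MvPowerSeries.X 0 ^ 2]

theorem hasSubst_paramLift : MvPowerSeries.HasSubst (paramLift k n) := by
  apply MvPowerSeries.hasSubst_of_constantCoeff_zero
  intro i
  fin_cases i <;> simp [paramLift]

/-- The specialization `v ↦ s^{2n+1} t`. -/
def paramSpecialize (k : Type*) [Field k] (n : ℕ) : Fin 3 → MvPowerSeries (Fin 2) k :=
  ![MvPowerSeries.X 0, MvPowerSeries.X 1, MvPowerSeries.X 0 ^ (2 * n + 1) * MvPowerSeries.X 1]

theorem hasSubst_paramSpecialize : MvPowerSeries.HasSubst (paramSpecialize k n) := by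
  apply MvPowerSeries.hasSubst_of_constantCoeff_zero
  intro i
  fin_cases i <;> simp [paramSpecialize]

/-- Because `φ_n` factors through the lift with `y` free, the kernel of that lift lies in `𝔭_n`. -/
theorem subst_paramSpecialize (f : MvPowerSeries (Fin 4) k) :
    MvPowerSeries.substAlgHom (R := k) (hasSubst_paramSpecialize (k := k) (n := n))
      (MvPowerSeries.substAlgHom (R := k) (hasSubst_paramLift (k := k) (n := n)) f) =
        phi k n f := by
  rw [MvPowerSeries.substAlgHom_apply, MvPowerSeries.substAlgHom_apply, phi,
    MvPowerSeries.substAlgHom_apply,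
    MvPowerSeries.subst_comp_subst_apply hasSubst_paramLift hasSubst_paramSpecialize]
  congr 1
  ext1 i
  rw [← MvPowerSeries.substAlgHom_apply (R := k) hasSubst_paramSpecialize]
  fin_cases i <;> simp only [paramLift, Fin.zero_eta, Fin.mk_one, Fin.reduceFinMk, Matrix.cons_val,
    map_mul, map_pow, MvPowerSeries.substAlgHom_X] <;> simp [param, paramSpecialize]

/-- In the chain `0 < q < 𝔭_n`, `q` is the kernel of the lift `y ↦ v`. It contains `x² - z^{2n+1} w`
but not `y z^n - x w^n`. -/
theorem two_le_height_p : 2 ≤ (p k n).height := by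
  have hdom : IsDomain (MvPowerSeries (Fin 3) k) := NoZeroDivisors.to_isDomain _
  have hdom' : IsDomain (MvPowerSeries (Fin 4) k) := NoZeroDivisors.to_isDomain _
  set q : Ideal (MvPowerSeries (Fin 4) k) :=
    RingHom.ker (MvPowerSeries.substAlgHom (R := k) (hasSubst_paramLift (k := k) (n := n))) with hq
  have hqp : q.IsPrime := RingHom.ker_isPrime _
  have hqle : q ≤ p k n := by
    intro f hf
    rw [← ker_phi, RingHom.mem_ker, ← subst_paramSpecialize, RingHom.mem_ker.1 hf, map_zero]
  have h1 : (⊥ : Ideal (MvPowerSeries (Fin 4) k)) < q := by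
    rw [bot_lt_iff_ne_bot, Submodule.ne_bot_iff]
    refine ⟨MvPowerSeries.X 0 ^ 2 - MvPowerSeries.X 2 ^ (2 * n + 1) * MvPowerSeries.X 3, ?_, ?_⟩
    · rw [hq, RingHom.mem_ker]
      simp only [map_sub, map_mul, map_pow, MvPowerSeries.substAlgHom_X, paramLift,
        Matrix.cons_val]
      ring
    · intro h
      classical
      have h2 := congrArg (MvPowerSeries.coeff (Finsupp.single 0 2)) h
      have h3 : (MvPowerSeries.X 3 : MvPowerSeries (Fin 4) k) ∣
        MvPowerSeries.X 2 ^ (2 * n + 1) * MvPowerSeries.X 3 := Dvd.intro_left _ rfl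
      rw [map_sub, MvPowerSeries.X_dvd_iff.1 h3 _ (by simp)] at h2
      simp [MvPowerSeries.X_pow_eq] at h2
  have h2 : q < p k n := by
    refine lt_of_le_of_ne hqle fun h => ?_
    have h3 : (MvPowerSeries.X 1 * MvPowerSeries.X 2 ^ n - MvPowerSeries.X 0 *
              MvPowerSeries.X 3 ^ n : MvPowerSeries (Fin 4) k) ∈ q := by
      rw [h]
      exact Ideal.subset_span (by simp)
    rw [hq, RingHom.mem_ker] at h3
    simp only [map_sub, map_mul, map_pow, MvPowerSeries.substAlgHom_X, paramLift,
      Matrix.cons_val] at h3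
    classical
    -- The coefficient of `v t^{2n}` is `1` in the image of `y z^n`, while the image of `x w^n` is
    -- divisible by `s`.
    have h4 := congrArg (MvPowerSeries.coeff
      (Finsupp.single 2 1 + n • 2 • Finsupp.single (1 : Fin 3) 1)) h3
    rw [map_sub, (MvPowerSeries.X_dvd_iff (s := 0)).1 ⟨_, mul_assoc (MvPowerSeries.X 0)
      (MvPowerSeries.X 1 ^ (2 * n + 1)) ((MvPowerSeries.X 0 ^ 2) ^ n)⟩ _ (by simp)] at h4
    simp only [MvPowerSeries.X, MvPowerSeries.monomial_pow, MvPowerSeries.monomial_mul_monomial,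
      MvPowerSeries.coeff_monomial, one_pow, mul_one, if_true, sub_zero, map_zero] at h4
    exact one_ne_zero h4
  have h3 := Ideal.height_add_one_le_of_lt_of_isPrime h1
  have h4 := Ideal.height_add_one_le_of_lt_of_isPrime h2
  rw [Ideal.height_bot, zero_add] at h3
  calc (2 : ℕ∞) = 1 + 1 := by norm_num
    _ ≤ q.height + 1 := by gcongr
    _ ≤ _ := h4

theorem exists_height_p : ∃ c : ℕ, (p k n).height = c ∧ 2 ≤ c := by
  obtain ⟨c, hc⟩ := ENat.ne_top_iff_exists.1 (Ideal.height_ne_top (p_ne_top k n))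
  refine ⟨c, hc.symm, ?_⟩
  have := two_le_height_p (k := k) (n := n)
  rw [← hc] at this
  exact_mod_cast this

end AbhyankarFamily

/-! ### Normality away from the closed point, and the isolated singularity. -/

/-- If `A` embeds in a normal domain `T` and `z ∉ P` multiplies into `A` the elements of `T` which
are fractions of `A`, then `A_P` is normal. -/
theorem Localization.AtPrime.isIntegrallyClosed_of_conductor {A T : Type*} [CommRing A] [IsDomain A]
    [CommRing T] [IsDomain T] [IsIntegrallyClosed T] (φ : A →+* T) (hφ : Function.Injective φ)
    (P : Ideal A) [P.IsPrime] (z : A) (hz : z ∉ P)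
    (H : ∀ a b : A, b ≠ 0 → ∀ τ : T, φ a = φ b * τ → ∃ r, φ r = φ z * τ) :
    IsIntegrallyClosed (Localization.AtPrime P) := by
  rw [isIntegrallyClosed_iff (FractionRing A)]
  intro x hx
  -- Clearing denominators makes `m • x` integral over `A`. Its image in the fraction field of `T`
  -- is then integral over `T`, hence lies in `T`.
  obtain ⟨m, hm⟩ := IsIntegral.exists_multiple_integral_of_isLocalization P.primeCompl x hx
  obtain ⟨a, b, hb, hab⟩ := IsFractionRing.div_surjective (A := A) (m • x)
  have hb0 : b ≠ 0 := nonZeroDivisors.ne_zero hb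
  have hbK : algebraMap A (FractionRing A) b ≠ 0 := by
    simpa using hb0
  have hinj : Function.Injective ((algebraMap T (FractionRing T)).comp φ) :=
    (IsFractionRing.injective T (FractionRing T)).comp hφ
  set ψ : FractionRing A →+* FractionRing T := IsFractionRing.lift hinj with hψ
  have hψa : ∀ c, ψ (algebraMap A _ c) = algebraMap T _ (φ c) := fun c =>
    IsFractionRing.lift_algebraMap hinj c
  obtain ⟨q, hq, hroot⟩ := hm
  have hint : IsIntegral T (ψ (m • x)) := by
    refine ⟨q.map φ, hq.map φ, ?_⟩
    rw [Polynomial.eval₂_map]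
    have : (algebraMap T (FractionRing T)).comp φ = ψ.comp (algebraMap A _) :=
      RingHom.ext fun c => (hψa c).symm
    rw [this, ← Polynomial.hom_eval₂, hroot, map_zero]
  obtain ⟨τ, hτ⟩ := IsIntegrallyClosed.isIntegral_iff.1 hint
  have h1 : φ a = φ b * τ := by
    apply IsFractionRing.injective T (FractionRing T)
    rw [map_mul, hτ, ← hψa, ← hψa, ← map_mul, ← hab, mul_div_cancel₀ _ hbK]
  obtain ⟨r, hr⟩ := H a b hb0 τ h1
  have h2 : r * b = z * a := by
    apply hφ
    rw [map_mul, map_mul, hr, h1]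
    ring
  have hzm : z * m ∈ P.primeCompl := P.primeCompl.mul_mem hz m.2
  -- Thus `x = r / (z m)` with `z m ∉ P`.
  have h3 : algebraMap A (FractionRing A) (z * m) * x = algebraMap A _ r := by
    have h4 : algebraMap A (FractionRing A) m * x * algebraMap A _ b = algebraMap A _ a := by
      rw [← Algebra.smul_def]
      change (m • x) * _ = _
      rw [← hab, div_mul_cancel₀ _ hbK]
    apply mul_right_cancel₀ hbK
    rw [← map_mul _ r b, h2, map_mul, map_mul, ← h4]
    ring
  refine ⟨IsLocalization.mk' _ r ⟨z * m, hzm⟩, ?_⟩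
  have hne : algebraMap A (FractionRing A) (z * m) ≠ 0 := by
    rw [Ne, FaithfulSMul.algebraMap_eq_zero_iff]
    intro h
    rw [h] at hzm
    exact hzm P.zero_mem
  apply mul_left_cancel₀ hne
  rw [h3, IsScalarTower.algebraMap_apply A (Localization.AtPrime P) (FractionRing A), ← map_mul,
    mul_comm, IsLocalization.mk'_spec, ← IsScalarTower.algebraMap_apply]

/-- A normal Noetherian domain of dimension at most one is Dedekind, and Dedekind domains are
regular. -/
theorem Localization.AtPrime.isRegularLocalRing_of_height_le_one {A : Type*} [CommRing A]
    [IsDomain A] [IsNoetherianRing A] (P : Ideal A) [P.IsPrime] (hP : P.height ≤ 1)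
    [IsIntegrallyClosed (Localization.AtPrime P)] :
    IsRegularLocalRing (Localization.AtPrime P) := by
  have hN : IsNoetherianRing (Localization.AtPrime P) :=
    IsLocalization.isNoetherianRing P.primeCompl _ inferInstance
  have hdom : IsDomain (Localization.AtPrime P) :=
    IsLocalization.isDomain_localization P.primeCompl_le_nonZeroDivisors
  have hdim : Ring.KrullDimLE 1 (Localization.AtPrime P) := by
    rw [Ring.krullDimLE_iff, IsLocalization.AtPrime.ringKrullDim_eq_height P]
    exact_mod_cast hP
  have : IsDedekindDomain (Localization.AtPrime P) :=
    { hdom, hN, ‹IsIntegrallyClosed (Localization.AtPrime P)› with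
      maximalOfPrime := fun h0 hp => hp.isMaximal_of_ne_bot h0 }
  exact IsRegularLocalRing.of_isRegularRing_of_isLocalRing _

theorem isRegularLocalRing_of_localization_maximalIdeal {A : Type*} [CommRing A] [IsLocalRing A]
    (h : IsRegularLocalRing (Localization.AtPrime (maximalIdeal A))) : IsRegularLocalRing A := by
  let e : A ≃ₐ[A] (Localization.AtPrime (maximalIdeal A)) :=
    IsLocalization.atUnits A (maximalIdeal A).primeCompl (fun x ↦ by simpa using! fun a ↦ a)
  exact IsRegularLocalRing.of_ringEquiv e.toRingEquiv.symm

/-- If `F` and `G = F τ` are supported on exponents of even degree and `F ≠ 0`, then so is `τ`. -/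
theorem MvPowerSeries.even_degree_of_mul {σ k : Type*} [Field k] {F G τ : MvPowerSeries σ k}
    (hF : ∀ μ : σ →₀ ℕ, coeff μ F ≠ 0 → Even μ.degree)
    (hG : ∀ μ : σ →₀ ℕ, coeff μ G ≠ 0 → Even μ.degree) (hF0 : F ≠ 0) (h : G = F * τ)
    (μ : σ →₀ ℕ) (hμ : coeff μ τ ≠ 0) : Even μ.degree := by
  classical
  -- `τ'` is the odd-degree part of `τ`. As `F` is even, `F * τ'` is the odd-degree part of `G`,
  -- which is zero.
  set τ' : MvPowerSeries σ k := ofCoeff fun μ => if Even μ.degree then 0 else coeff μ τ with hτ'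
  have h0 : F * τ' = 0 := by
    ext ν
    rw [map_zero]
    by_cases hν : Even ν.degree
    · rw [coeff_mul]
      refine Finset.sum_eq_zero fun q hq => ?_
      rw [Finset.HasAntidiagonal.mem_antidiagonal] at hq
      by_contra hne
      have h1 := hF q.1 (left_ne_zero_of_mul hne)
      have h2 : Even q.2.degree := by
        rw [← hq, map_add] at hν
        exact (Nat.even_add.1 hν).1 h1
      apply right_ne_zero_of_mul hne
      rw [hτ', coeff_ofCoeff, if_pos h2]
    · have h1 : coeff ν G = 0 := not_imp_comm.1 (hG ν) hν
      rw [← h1, h, coeff_mul, coeff_mul]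
      refine Finset.sum_congr rfl fun q hq => ?_
      rw [Finset.HasAntidiagonal.mem_antidiagonal] at hq
      by_cases hne : coeff q.1 F = 0
      · rw [hne, zero_mul, zero_mul]
      · have h1 := hF q.1 hne
        have h2 : ¬ Even q.2.degree := by
          intro h2
          apply hν
          rw [← hq, map_add]
          exact h1.add h2
        rw [hτ', coeff_ofCoeff, if_neg h2]
  have h1 := (mul_eq_zero.1 h0).resolve_left hF0
  by_contra hodd
  apply hμ
  have := congrArg (coeff μ) h1
  rwa [hτ', coeff_ofCoeff, if_neg hodd, map_zero] at this

namespace AbhyankarFamily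

variable {k : Type*} [Field k] {n : ℕ}

theorem degree_fin_two (d : Fin 2 →₀ ℕ) : d.degree = d 0 + d 1 := by
  rw [Finsupp.degree_eq_sum, Fin.sum_univ_two]

theorem even_degree_of_coeff_phi_ne_zero {f : MvPowerSeries (Fin 4) k} {μ : Fin 2 →₀ ℕ}
    (h : MvPowerSeries.coeff μ (phi k n f) ≠ 0) : Even μ.degree := by
  obtain ⟨d, rfl, -⟩ := exists_of_coeff_phi_ne_zero h
  rw [degree_fin_two, imgExp_zero, imgExp_one]
  exact ⟨(n + 1) * (d 0 + d 1) + d 2 + d 3, by ring⟩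

/-- If `μ 1` is even, `z^c w^e` works. If it is odd, `x z^c w^e` works when `μ 1 ≥ 2n`; otherwise `μ
0 ≥ 2n` leaves room for the factor `s^{2n+1}` of `y`, and `c < n` holds. -/
theorem exists_isNormal_imgExp {μ : Fin 2 →₀ ℕ} (he : Even μ.degree)
    (h : 2 * n ≤ μ 0 ∨ 2 * n ≤ μ 1) : ∃ d, IsNormal n d ∧ imgExp n d = μ := by
  rw [degree_fin_two] at he
  simp only [imgExp_eq_iff, IsNormal]
  obtain ⟨m, hm⟩ := he
  rcases Nat.even_or_odd' (μ 1) with ⟨b, hb | hb⟩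
  · exact ⟨expo 0 0 b (m - b), by simp, by simp; lia⟩
  · by_cases hbn : 2 * n ≤ μ 1
    · exact ⟨expo 1 0 (b - n) (m - b - 1), by simp, by simp; lia⟩
    · exact ⟨expo 0 1 b (m - b - 1 - n), by simp; lia, by simp; lia⟩

/-- Multiplication by `s^{2n}` or `t^{2n}` pushes every even exponent into the range where a normal
monomial hits it. -/
theorem exists_phi_eq_X_pow_mul {τ : MvPowerSeries (Fin 2) k} (i : Fin 2)
    (hτ : ∀ μ : Fin 2 →₀ ℕ, MvPowerSeries.coeff μ τ ≠ 0 → Even μ.degree) :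
    ∃ f, phi k n f = (MvPowerSeries.X i ^ 2) ^ n * τ := by
  refine ⟨_, phi_normalLift fun μ hμ => ?_⟩
  rw [← pow_mul, MvPowerSeries.X_pow_eq, MvPowerSeries.coeff_monomial_mul] at hμ
  split_ifs at hμ with hle
  · rw [one_mul] at hμ
    have h1 := hτ _ hμ
    have h2 : μ - Finsupp.single i (2 * n) + Finsupp.single i (2 * n) = μ :=
      tsub_add_cancel_of_le hle
    apply exists_isNormal_imgExp
    · rw [← h2, map_add, Finsupp.degree_single]
      exact h1.add (even_two_mul n)
    · have h3 := hle i
      rw [Finsupp.single_eq_same] at h3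
      fin_cases i
      exacts [Or.inl h3, Or.inr h3]
  · exact absurd rfl hμ

/-- The prime misses `z` or `w`, and the `n`-th power of the missed one serves as the conductor
element: fractions of `R_n` lying in `k[[s, t]]` are even. -/
theorem isIntegrallyClosed_localization_R {P : Ideal (R k n)} [hP : P.IsPrime]
    (hne : P ≠ maximalIdeal (R k n)) : IsIntegrallyClosed (Localization.AtPrime P) := by
  have := isDomain_R (k := k) (n := n)
  have := MvPowerSeries.uniqueFactorizationMonoid_fin_two k
  have key : ∀ (j : Fin 4) (i : Fin 2), param k n j = MvPowerSeries.X i ^ 2 →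
      Ideal.Quotient.mk (p k n) (MvPowerSeries.X j) ∉ P →
      IsIntegrallyClosed (Localization.AtPrime P) := by
    intro j i hji hj
    refine Localization.AtPrime.isIntegrallyClosed_of_conductor (T := MvPowerSeries (Fin 2) k)
      (phiBar k n).toRingHom (phiBar_injective (k := k) (n := n)) P
        (Ideal.Quotient.mk (p k n) (MvPowerSeries.X j) ^ n)
      (fun h => hj (hP.mem_of_pow_mem n h)) fun a b hb τ hab => ?_
    obtain ⟨f, rfl⟩ := Ideal.Quotient.mk_surjective a
    obtain ⟨g, rfl⟩ := Ideal.Quotient.mk_surjective b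
    have hg : phi k n g ≠ 0 := by
      rw [← phiBar_mk]
      exact (map_ne_zero_iff _ phiBar_injective).2 hb
    obtain ⟨r, hr⟩ := exists_phi_eq_X_pow_mul (n := n) i
      (MvPowerSeries.even_degree_of_mul (fun μ => even_degree_of_coeff_phi_ne_zero)
      (fun μ => even_degree_of_coeff_phi_ne_zero) hg hab)
    refine ⟨Ideal.Quotient.mk (p k n) r, ?_⟩
    rw [map_pow]
    change phi k n r = phi k n (MvPowerSeries.X j) ^ n * τ
    rw [hr, phi_X, hji]
  by_cases hz : Ideal.Quotient.mk (p k n) (MvPowerSeries.X 2) ∈ P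
  · by_cases hw : Ideal.Quotient.mk (p k n) (MvPowerSeries.X 3) ∈ P
    · exact absurd (eq_maximalIdeal_of_mem hz hw) hne
    · exact key 3 0 rfl hw
  · exact key 2 1 rfl hz

theorem hasIsolatedSingularity_R (hn : 1 ≤ n) : HasIsolatedSingularity (R k n) := by
  have := isDomain_R (k := k) (n := n)
  intro P hP
  constructor
  · rintro hreg rfl
    have h1 := isRegularLocalRing_of_localization_maximalIdeal hreg
    have h2 := h1.spanFinrank_maximalIdeal
    rw [ringKrullDim_R, spanFinrank_maximalIdeal_R hn] at h2
    exact absurd h2 (by decide)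
  · intro hne
    have := isIntegrallyClosed_localization_R hne
    apply Localization.AtPrime.isRegularLocalRing_of_height_le_one
    have hlt : P < maximalIdeal (R k n) := lt_of_le_of_ne (le_maximalIdeal hP.ne_top) hne
    have h := Ideal.height_add_one_le_of_lt_of_isPrime hlt
    rw [height_maximalIdeal_R] at h
    exact (ENat.add_le_add_iff_right (by simp)).1 (h.trans_eq one_add_one_eq_two.symm)

end AbhyankarFamily

/-! ### Rings with primary zero ideal. -/

section Unmixed

variable {A : Type*} [CommRing A]

/-- A ring whose zero ideal is primary satisfies `(S₁)`. -/
theorem serreCondition_one_of_mul_eq_zero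
    (H : ∀ x y : A, x * y = 0 → x = 0 ∨ y ∈ nilradical A) : SerreCondition 1 A := by
  intro P hP
  -- Either `P` is minimal and its localization has dimension zero, or `P` contains a non-nilpotent
  -- element, which is a nonzerodivisor and remains one in the localization.
  by_cases hle : P ≤ nilradical A
  · have hmin : P ∈ minimalPrimes A :=
      ⟨⟨hP, bot_le⟩, fun q hq _ => by
        have := hq.1
        exact hle.trans (nilradical_le_prime q)⟩
    refine (min_le_right _ _).trans ?_
    rw [IsLocalization.AtPrime.ringKrullDim_eq_height P, Ideal.height_eq_zero_iff.2 hmin]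
    exact_mod_cast bot_le
  · obtain ⟨a, haP, ha⟩ := Set.not_subset.1 hle
    have hreg : algebraMap A (Localization.AtPrime P) a ∈
        nonZeroDivisors (Localization.AtPrime P) := by
      refine IsLocalization.map_nonZeroDivisors_le P.primeCompl _ ⟨a, ?_, rfl⟩
      rw [SetLike.mem_coe, mem_nonZeroDivisors_iff_right]
      exact fun x hx => (H x a hx).resolve_right ha
    have hmem : algebraMap A (Localization.AtPrime P) a ∈
        maximalIdeal (Localization.AtPrime P) :=
      (IsLocalization.AtPrime.to_map_mem_maximal_iff _ P a).2 haP
    have hseq : RingTheory.Sequence.IsRegular (Localization.AtPrime P)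
        [algebraMap A (Localization.AtPrime P) a] := by
      rw [RingTheory.Sequence.isRegular_iff, RingTheory.Sequence.isWeaklyRegular_cons_iff]
      refine ⟨⟨?_, RingTheory.Sequence.IsWeaklyRegular.nil _ _⟩, ?_⟩
      · intro x y hxy
        exact (mul_cancel_left_mem_nonZeroDivisors hreg).1 hxy
      · intro htop
        rw [Ideal.ofList_singleton, smul_eq_mul, Ideal.mul_top] at htop
        apply (maximalIdeal.isMaximal (Localization.AtPrime P)).ne_top
        rw [eq_top_iff, htop, Ideal.span_singleton_le_iff_mem]
        exact hmem
    refine (min_le_left _ _).trans ?_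
    have h1 : (1 : ℕ∞) ≤ localDepth (Localization.AtPrime P) :=
      le_iSup_of_le (ι := {rs : List (Localization.AtPrime P) //
        (∀ r ∈ rs, r ∈ maximalIdeal _) ∧ RingTheory.Sequence.IsRegular _ rs})
        (f := fun rs => (rs.1.length : ℕ∞)) ⟨_, by simpa using hmem, hseq⟩ (by simp)
    exact_mod_cast h1

/-- A ring whose zero ideal is primary is unmixed. -/
theorem isUnmixedRing_of_mul_eq_zero
    (H : ∀ x y : A, x * y = 0 → x = 0 ∨ y ∈ nilradical A) : IsUnmixedRing A := by
  intro q hq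
  obtain ⟨hqp, x, hx⟩ := hq
  have hle : q ≤ nilradical A := by
    intro y hy
    rw [hx] at hy
    -- Some power of `y` kills `x`; if `x` were zero then `q` would be the whole ring.
    obtain ⟨m, hm⟩ := hy
    rw [Submodule.mem_colon_singleton, Submodule.mem_bot, smul_eq_mul, mul_comm] at hm
    rcases H x _ hm with h | h
    · exfalso
      apply hqp.ne_top
      rw [hx, h, Ideal.eq_top_iff_one]
      exact ⟨1, by simp [Submodule.mem_colon_singleton]⟩
    · exact Ideal.mem_radical_of_pow_mem h
  have hzero : PrimeSpectrum.zeroLocus (q : Set A) = Set.univ :=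
    Set.eq_univ_of_forall fun P => hle.trans (nilradical_le_prime P.asIdeal)
  rw [ringKrullDim_quotient, hzero, ringKrullDim]
  exact Order.krullDim_eq_of_orderIso OrderIso.Set.univ

end Unmixed

/-! ### Presenting the associated graded ring by a polynomial ring. -/

namespace AssocGraded

variable {A : Type*} [CommRing A] (I : Ideal A)

theorem coeff_mem_of_mem_map {f : ↥(reesAlgebra I)}
    (hf : f ∈ I.map (algebraMap A ↥(reesAlgebra I))) :
    ∀ j, (f : Polynomial A).coeff j ∈ I ^ (j + 1) := by
  induction hf using Submodule.span_induction with
  | mem x hx =>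
    intro j
    obtain ⟨a, ha, rfl⟩ := hx
    change (Polynomial.C a).coeff j ∈ _
    rw [Polynomial.coeff_C]
    split_ifs with h
    · rw [h, zero_add, pow_one]
      exact ha
    · exact zero_mem _
  | zero => simp
  | add x y _ _ hx hy =>
    intro j
    change ((x : Polynomial A) + y).coeff j ∈ _
    rw [Polynomial.coeff_add]
    exact add_mem (hx j) (hy j)
  | smul r x _ hx =>
    intro j
    change ((r : Polynomial A) * x).coeff j ∈ _
    rw [Polynomial.coeff_mul]
    refine Ideal.sum_mem _ fun q hq => ?_
    rw [← Finset.HasAntidiagonal.mem_antidiagonal.1 hq, add_assoc, pow_add]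
    exact Ideal.mul_mem_mul (r.2 q.1) (hx q.2)

theorem monomial_mem_map {j : ℕ} {a : A} (ha : a ∈ I ^ j) (ha' : a ∈ I ^ (j + 1)) :
    (⟨Polynomial.monomial j a, reesAlgebra.monomial_mem.mpr ha⟩ : ↥(reesAlgebra I)) ∈
      I.map (algebraMap A ↥(reesAlgebra I)) := by
  -- Membership in `I ^ j` is carried through the induction because the Rees algebra element depends
  -- on its proof.
  have key : ∀ b ∈ I ^ (j + 1), ∃ hb : b ∈ I ^ j,
      (⟨Polynomial.monomial j b, reesAlgebra.monomial_mem.mpr hb⟩ : ↥(reesAlgebra I)) ∈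
        I.map (algebraMap A ↥(reesAlgebra I)) := by
    intro b hb
    rw [pow_succ'] at hb
    refine Submodule.mul_induction_on hb ?_ ?_
    · intro x hx y hy
      refine ⟨Ideal.mul_mem_left _ _ hy, ?_⟩
      have h := Ideal.mul_mem_right (⟨Polynomial.monomial j y, reesAlgebra.monomial_mem.mpr hy⟩ :
        ↥(reesAlgebra I)) _ (Ideal.mem_map_of_mem (algebraMap A ↥(reesAlgebra I)) hx)
      convert h using 1
      apply Subtype.ext
      change _ = Polynomial.C x * Polynomial.monomial j y
      rw [Polynomial.C_mul_monomial]
    · rintro x y ⟨hx, hx'⟩ ⟨hy, hy'⟩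
      refine ⟨add_mem hx hy, ?_⟩
      have h := Ideal.add_mem _ hx' hy'
      convert h using 1
      apply Subtype.ext
      exact map_add _ _ _
  exact (key a ha').2

/-- In degree `j` the extended ideal is `I · I^j = I^{j+1}`, so the quotient of the Rees algebra has
graded pieces `I^j / I^{j+1}`. -/
theorem mem_map_iff {f : ↥(reesAlgebra I)} : f ∈ I.map (algebraMap A ↥(reesAlgebra I)) ↔
    ∀ j, (f : Polynomial A).coeff j ∈ I ^ (j + 1) := by
  refine ⟨coeff_mem_of_mem_map I, fun h => ?_⟩
  have hf : f = ∑ j ∈ (f : Polynomial A).support,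
      (⟨Polynomial.monomial j ((f : Polynomial A).coeff j),
        reesAlgebra.monomial_mem.mpr (f.2 j)⟩ : ↥(reesAlgebra I)) := by
    apply Subtype.ext
    rw [AddSubmonoidClass.coe_finsetSum]
    exact (f : Polynomial A).as_sum_support
  rw [hf]
  exact Ideal.sum_mem _ fun j _ => monomial_mem_map I (f.2 j) (h j)

section Presentation

variable {k : Type*} [Field k] [Algebra k A] {σ : Type*} (x : σ → A) (hx : ∀ i, x i ∈ I ^ 1)

/-- The homomorphism from a polynomial ring to the Rees algebra given by elements of `I`. -/
def reesHom : MvPolynomial σ k →ₐ[k] ↥(reesAlgebra I) :=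
  MvPolynomial.aeval fun i => ⟨Polynomial.monomial 1 (x i), reesAlgebra.monomial_mem.mpr (hx i)⟩

theorem coe_reesHom_monomial (d : σ →₀ ℕ) (c : k) :
    (reesHom I x hx (MvPolynomial.monomial d c) : Polynomial A) =
      Polynomial.monomial d.degree (MvPolynomial.aeval x (MvPolynomial.monomial d c)) := by
  have h : ((reesAlgebra I).val.restrictScalars k).comp (reesHom I x hx) =
      MvPolynomial.aeval fun i => Polynomial.monomial 1 (x i) := by
    apply MvPolynomial.algHom_ext
    intro i
    simp [reesHom]
  have h2 := DFunLike.congr_fun h (MvPolynomial.monomial d c)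
  refine h2.trans ?_
  rw [MvPolynomial.aeval_monomial, MvPolynomial.aeval_monomial, Finsupp.prod, Finsupp.prod,
    ← Algebra.smul_def, ← Algebra.smul_def, ← Polynomial.smul_monomial]
  congr 1
  rw [Finsupp.degree_apply]
  induction d.support using Finset.cons_induction with
  | empty => simp
  | cons a s ha ih =>
    rw [Finset.prod_cons, ih, Finset.prod_cons, Finset.sum_cons, Polynomial.monomial_pow,
      Polynomial.monomial_mul_monomial, mul_comm 1]
    simp

theorem coeff_reesHom (g : MvPolynomial σ k) (j : ℕ) :
    (reesHom I x hx g : Polynomial A).coeff j =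
      MvPolynomial.aeval x (MvPolynomial.homogeneousComponent j g) := by
  induction g using MvPolynomial.induction_on' with
  | monomial d c =>
    rw [coe_reesHom_monomial, Polynomial.coeff_monomial, MvPolynomial.homogeneousComponent_of_mem
      (MvPolynomial.isHomogeneous_monomial c rfl)]
    simp only [eq_comm (a := j)]
    split_ifs <;> simp
  | add g h hg hh =>
    rw [map_add, map_add, map_add, ← hg, ← hh, ← Polynomial.coeff_add]
    rfl

/-- The homomorphism from a polynomial ring to the associated graded ring given by elements
of `I`. -/
def polyHom : MvPolynomial σ k →ₐ[k] AssocGraded I :=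
  (Ideal.Quotient.mkₐ k (I.map (algebraMap A ↥(reesAlgebra I)))).comp (reesHom I x hx)

theorem polyHom_X (i : σ) :
    polyHom (k := k) I x hx (MvPolynomial.X i) = AssocGraded.of I 1 (x i) (hx i) := by
  rw [polyHom, AlgHom.comp_apply, reesHom, MvPolynomial.aeval_X]
  rfl

theorem polyHom_eq_zero_iff {g : MvPolynomial σ k} : polyHom I x hx g = 0 ↔
    ∀ j, MvPolynomial.aeval x (MvPolynomial.homogeneousComponent j g) ∈ I ^ (j + 1) := by
  simp only [← coeff_reesHom I x hx]
  rw [← mem_map_iff]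
  exact Ideal.Quotient.eq_zero_iff_mem

theorem polyHom_eq_zero_iff_of_isHomogeneous {g : MvPolynomial σ k} {m : ℕ}
    (hg : g.IsHomogeneous m) :
    polyHom I x hx g = 0 ↔ MvPolynomial.aeval x g ∈ I ^ (m + 1) := by
  rw [polyHom_eq_zero_iff]
  simp only [MvPolynomial.homogeneousComponent_of_mem hg]
  constructor
  · intro h
    simpa using h m
  · intro h j
    split_ifs with hj
    · rwa [hj]
    · simp

/-- Each coefficient of a Rees algebra element is approximated by a form of its own degree, and the
finitely many forms are added. -/
theorem polyHom_surjective (H : ∀ j, ∀ a ∈ I ^ j, ∃ g : MvPolynomial σ k, g.IsHomogeneous j ∧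
    a - MvPolynomial.aeval x g ∈ I ^ (j + 1)) : Function.Surjective (polyHom (k := k) I x hx) := by
  intro y
  obtain ⟨f, rfl⟩ := Ideal.Quotient.mk_surjective y
  choose g hg hfg using fun j => H j _ (f.2 j)
  refine ⟨∑ j ∈ (f : Polynomial A).support, g j, ?_⟩
  change Ideal.Quotient.mk _ (reesHom I x hx _) = _
  rw [Ideal.Quotient.eq, ← neg_mem_iff, neg_sub, mem_map_iff]
  intro j
  have h1 : ((f - reesHom I x hx (∑ j ∈ (f : Polynomial A).support, g j) : ↥(reesAlgebra I)) :
      Polynomial A).coeff j = (f : Polynomial A).coeff j -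
        (reesHom I x hx (∑ j ∈ (f : Polynomial A).support, g j) : Polynomial A).coeff j :=
    Polynomial.coeff_sub _ _ _
  rw [h1, coeff_reesHom, map_sum]
  simp only [MvPolynomial.homogeneousComponent_of_mem (hg _)]
  rw [Finset.sum_ite_eq]
  split_ifs with hj
  · exact hfg j
  · rw [Polynomial.notMem_support_iff.1 hj]
    simp

end Presentation

end AssocGraded

/-! ### The ideal `J` as the kernel of a map to dual numbers. -/

namespace AbhyankarFamily

variable {k : Type*} [Field k] {n : ℕ}

section Primary

open MvPolynomial

variable (k n) in
/-- The homomorphism `k[X, Y, Z, W] → k[Z, W][ε]`, `X ↦ Z^n ε`, `Y ↦ W^n ε`, with kernel `J`. -/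
def dualHom : MvPolynomial (Fin 4) k →ₐ[k] DualNumber (MvPolynomial (Fin 2) k) :=
  aeval ![TrivSqZeroExt.inr (X 0 ^ n), TrivSqZeroExt.inr (X 1 ^ n), TrivSqZeroExt.inl (X 0),
    TrivSqZeroExt.inl (X 1)]

variable (k) in
/-- The inclusion of `k[Z, W]` in `k[X, Y, Z, W]`. -/
def inclZW : MvPolynomial (Fin 2) k →ₐ[k] MvPolynomial (Fin 4) k := aeval ![X 2, X 3]

variable (k n) in
/-- The linear map from `k[Z, W]` to `k[X, Y, Z, W]` with `Z^{n+c} W^e ↦ X Z^c W^e` and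
`Z^c W^{n+e} ↦ Y Z^c W^e` for `c < n`. -/
def liftEps : MvPolynomial (Fin 2) k →ₗ[k] MvPolynomial (Fin 4) k :=
  (basisMonomials (Fin 2) k).constr k fun m =>
    -- If both exponents are below `n`, the truncated subtraction yields a junk value. This does no
    -- harm, since `ε`-parts of images under `dualHom` lie in `(Z^n, W^n)`.
    if n ≤ m 0 then monomial (expo 1 0 (m 0 - n) (m 1)) 1
    else monomial (expo 0 1 (m 0) (m 1 - n)) 1

theorem liftEps_monomial (c e : ℕ) : liftEps k n (X 0 ^ c * X 1 ^ e) =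
    if n ≤ c then monomial (expo 1 0 (c - n) e) 1 else monomial (expo 0 1 c (e - n)) 1 := by
  have h : (X 0 ^ c * X 1 ^ e : MvPolynomial (Fin 2) k) =
      basisMonomials (Fin 2) k (Finsupp.single 0 c + Finsupp.single 1 e) := by
    rw [coe_basisMonomials, X_pow_eq_monomial, X_pow_eq_monomial, monomial_mul, mul_one]
  rw [h, liftEps, Module.Basis.constr_basis]
  simp

variable (k n) in
/-- The linear section of `dualHom`. -/
def dualLift : DualNumber (MvPolynomial (Fin 2) k) →ₗ[k] MvPolynomial (Fin 4) k :=
  (inclZW k).toLinearMap ∘ₗ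
      (TrivSqZeroExt.fstHom k (MvPolynomial (Fin 2) k) (MvPolynomial (Fin 2) k)).toLinearMap
    + liftEps k n ∘ₗ (TrivSqZeroExt.sndHom (MvPolynomial (Fin 2) k)
      (MvPolynomial (Fin 2) k)).restrictScalars k

theorem dualLift_apply (v : DualNumber (MvPolynomial (Fin 2) k)) :
    dualLift k n v = inclZW k v.fst + liftEps k n v.snd := rfl

theorem dualHom_monomial (a b c e : ℕ) : dualHom k n (monomial (expo a b c e) 1) =
    TrivSqZeroExt.inr (X 0 ^ n) ^ a * TrivSqZeroExt.inr (X 1 ^ n) ^ b *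
      TrivSqZeroExt.inl (X 0 ^ c * X 1 ^ e) := by
  rw [mvPolynomial_monomial_expo, dualHom]
  simp only [map_mul, map_pow, aeval_X, Matrix.cons_val, TrivSqZeroExt.inl_mul,
    TrivSqZeroExt.inl_pow]
  ring

theorem inr_pow_eq_zero {B : Type*} [CommRing B] (x : B) {a : ℕ} (ha : 2 ≤ a) :
    (TrivSqZeroExt.inr x : DualNumber B) ^ a = 0 := by
  obtain ⟨m, rfl⟩ := Nat.exists_eq_add_of_le ha
  rw [pow_add, sq, TrivSqZeroExt.inr_mul_inr, zero_mul]

theorem dualHom_apply_of_mem_J {g : MvPolynomial (Fin 4) k} (hg : g ∈ J k n) :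
    dualHom k n g = 0 := by
  have : J k n ≤ RingHom.ker (dualHom k n) := by
    rw [J, Ideal.span_le]
    intro f hf
    simp only [Set.mem_insert_iff, Set.mem_singleton_iff] at hf
    rw [SetLike.mem_coe, RingHom.mem_ker]
    rcases hf with rfl | rfl | rfl | rfl <;>
      simp only [map_sub, map_mul, map_pow, dualHom, aeval_X, Matrix.cons_val]
    · exact inr_pow_eq_zero _ le_rfl
    · exact TrivSqZeroExt.inr_mul_inr _ _ _
    · exact inr_pow_eq_zero _ le_rfl
    · rw [TrivSqZeroExt.inl_pow, TrivSqZeroExt.inl_pow, mul_comm, TrivSqZeroExt.inl_mul_inr,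
        mul_comm, TrivSqZeroExt.inl_mul_inr, smul_eq_mul, smul_eq_mul, mul_comm, sub_self]
  exact this hg

variable (k n) in
/-- The polynomials all of whose monomials are normal. -/
def normalPolys : Submodule k (MvPolynomial (Fin 4) k) where
  carrier := {g | ∀ d, ¬ IsNormal n d → coeff d g = 0}
  add_mem' hg hh d hd := by rw [coeff_add, hg d hd, hh d hd, add_zero]
  zero_mem' _ _ := coeff_zero _
  smul_mem' c g hg d hd := by rw [coeff_smul, hg d hd, smul_zero]

theorem monomial_mem_normalPolys {d : Fin 4 →₀ ℕ} (hd : IsNormal n d) (c : k) :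
    monomial d c ∈ normalPolys k n := by
  classical
  intro e he
  rw [coeff_monomial, if_neg]
  rintro rfl
  exact he hd

theorem inclZW_monomial (c e : ℕ) :
    inclZW k (X 0 ^ c * X 1 ^ e) = monomial (expo 0 0 c e) 1 := by
  rw [mvPolynomial_monomial_expo, inclZW]
  simp

/-- Monomials of degree at least two in `X, Y` lie in `J` and map to zero. The others return
unchanged, except that `Y Z^{n+c} W^e` becomes `X Z^c W^{n+e}`, congruent modulo the last generator.
-/
theorem dualLift_dualHom_monomial (d : Fin 4 →₀ ℕ) :
    dualLift k n (dualHom k n (monomial d 1)) ∈ normalPolys k n ∧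
      monomial d 1 - dualLift k n (dualHom k n (monomial d 1)) ∈ J k n := by
  rw [← expo_eta d]
  generalize d 0 = a, d 1 = b, d 2 = c, d 3 = e
  have hzero : monomial (expo a b c e) 1 ∈ J k n →
      dualLift k n (dualHom k n (monomial (expo a b c e) 1)) ∈ normalPolys k n ∧
      monomial (expo a b c e) 1 - dualLift k n (dualHom k n (monomial (expo a b c e) 1)) ∈
        J k n := by
    intro h
    rw [dualHom_apply_of_mem_J h, map_zero, sub_zero]
    exact ⟨zero_mem _, h⟩
  by_cases ha : 2 ≤ a
  · apply hzero
    obtain ⟨a, rfl⟩ := Nat.exists_eq_add_of_le ha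
    rw [mvPolynomial_monomial_expo, pow_add, mul_assoc, mul_assoc, mul_assoc]
    exact Ideal.mul_mem_right _ _ (Ideal.subset_span (by simp))
  by_cases hb : 2 ≤ b
  · apply hzero
    obtain ⟨b, rfl⟩ := Nat.exists_eq_add_of_le hb
    rw [mvPolynomial_monomial_expo, pow_add, mul_left_comm, mul_assoc, mul_assoc]
    exact Ideal.mul_mem_right _ _ (Ideal.subset_span (by simp))
  by_cases hab : a = 1 ∧ b = 1
  · apply hzero
    obtain ⟨rfl, rfl⟩ := hab
    rw [mvPolynomial_monomial_expo, pow_one, pow_one, mul_assoc]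
    exact Ideal.mul_mem_right _ _ (Ideal.subset_span (by simp))
  rw [dualHom_monomial]
  obtain ⟨rfl, rfl⟩ | ⟨rfl, rfl⟩ | ⟨rfl, rfl⟩ : (a = 0 ∧ b = 0) ∨ (a = 1 ∧ b = 0) ∨
    (a = 0 ∧ b = 1) := by lia
  · rw [pow_zero, pow_zero, one_mul, one_mul, dualLift_apply, TrivSqZeroExt.fst_inl,
      TrivSqZeroExt.snd_inl, map_zero, add_zero, inclZW_monomial, sub_self]
    exact ⟨monomial_mem_normalPolys (by simp [IsNormal]) 1, zero_mem _⟩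
  · rw [pow_zero, pow_one, mul_one, mul_comm, TrivSqZeroExt.inl_mul_inr, dualLift_apply,
      TrivSqZeroExt.fst_inr, TrivSqZeroExt.snd_inr, map_zero, zero_add, smul_eq_mul,
      mul_right_comm, ← pow_add, liftEps_monomial, if_pos (by lia), Nat.add_sub_cancel, sub_self]
    exact ⟨monomial_mem_normalPolys (by simp [IsNormal]) 1, zero_mem _⟩
  · rw [pow_zero, pow_one, one_mul, mul_comm, TrivSqZeroExt.inl_mul_inr, dualLift_apply,
      TrivSqZeroExt.fst_inr, TrivSqZeroExt.snd_inr, map_zero, zero_add, smul_eq_mul,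
      mul_assoc, ← pow_add, liftEps_monomial]
    split_ifs with hc
    · refine ⟨monomial_mem_normalPolys (by simp [IsNormal]) 1, ?_⟩
      obtain ⟨c, rfl⟩ := Nat.exists_eq_add_of_le hc
      rw [Nat.add_sub_cancel_left, mvPolynomial_monomial_expo, mvPolynomial_monomial_expo]
      have h : (X 1 * X 2 ^ n - X 0 * X 3 ^ n : MvPolynomial (Fin 4) k) ∈ J k n :=
        Ideal.subset_span (by simp)
      convert Ideal.mul_mem_left _ (X 2 ^ c * X 3 ^ e) h using 1
      ring
    · rw [Nat.add_sub_cancel, sub_self]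
      exact ⟨monomial_mem_normalPolys (by simp [IsNormal]; lia) 1, zero_mem _⟩

theorem dualLift_dualHom (g : MvPolynomial (Fin 4) k) :
    dualLift k n (dualHom k n g) ∈ normalPolys k n ∧
      g - dualLift k n (dualHom k n g) ∈ J k n := by
  induction g using MvPolynomial.induction_on' with
  | monomial d c =>
    have h : monomial d c = c • monomial d (1 : k) := by rw [smul_monomial, smul_eq_mul, mul_one]
    obtain ⟨h1, h2⟩ := dualLift_dualHom_monomial (k := k) (n := n) d
    rw [h, map_smul, map_smul, ← smul_sub]
    refine ⟨Submodule.smul_mem _ _ h1, ?_⟩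
    rw [Algebra.smul_def]
    exact Ideal.mul_mem_left _ _ h2
  | add f g hf hg =>
    rw [map_add, map_add, add_sub_add_comm]
    exact ⟨add_mem hf.1 hg.1, add_mem hf.2 hg.2⟩

theorem mem_J_iff {g : MvPolynomial (Fin 4) k} : g ∈ J k n ↔ dualHom k n g = 0 := by
  refine ⟨dualHom_apply_of_mem_J, fun h => ?_⟩
  have := (dualLift_dualHom (n := n) g).2
  rwa [h, map_zero, sub_zero] at this

/-- The first component of `dualHom` sets `X` and `Y` to zero. -/
theorem fst_dualHom_eq_zero_iff {g : MvPolynomial (Fin 4) k} :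
    (dualHom k n g).fst = 0 ↔ g ∈ Ideal.span {X 0, X 1} := by
  constructor
  · intro h
    have key : (Ideal.Quotient.mkₐ k (Ideal.span {(X 0 : MvPolynomial (Fin 4) k), X 1})).comp
        ((inclZW k).comp ((TrivSqZeroExt.fstHom k _ _).comp (dualHom k n))) =
        Ideal.Quotient.mkₐ k _ := by
      apply MvPolynomial.algHom_ext
      intro i
      have h0 : ∀ j : Fin 4, (j = 0 ∨ j = 1) → Ideal.Quotient.mk
          (Ideal.span {(X 0 : MvPolynomial (Fin 4) k), X 1}) (X j) = 0 := by
        rintro j (rfl | rfl) <;>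
          exact Ideal.Quotient.eq_zero_iff_mem.2 (Ideal.subset_span (by simp))
      fin_cases i <;> simp [dualHom, inclZW, h0]
    have h2 := DFunLike.congr_fun key g
    have h3 : Ideal.Quotient.mk (Ideal.span {(X 0 : MvPolynomial (Fin 4) k), X 1}) g = 0 := by
      refine h2.symm.trans ?_
      change Ideal.Quotient.mk _ (inclZW k (dualHom k n g).fst) = 0
      rw [h, map_zero, map_zero]
    exact Ideal.Quotient.eq_zero_iff_mem.1 h3
  · intro h
    have : Ideal.span {X 0, X 1} ≤
        RingHom.ker ((TrivSqZeroExt.fstHom k _ _).comp (dualHom k n)) := by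
      rw [Ideal.span_le]
      rintro _ (rfl | rfl) <;> simp [RingHom.mem_ker, dualHom]
    exact this h

theorem radical_J : (J k n).radical = Ideal.span {X 0, X 1} := by
  apply le_antisymm
  · rintro g ⟨m, hm⟩
    rw [mem_J_iff, map_pow] at hm
    rw [← fst_dualHom_eq_zero_iff]
    have := congrArg TrivSqZeroExt.fst hm
    rw [TrivSqZeroExt.fst_pow, TrivSqZeroExt.fst_zero] at this
    exact eq_zero_of_pow_eq_zero this
  · rw [Ideal.span_le]
    rintro _ (rfl | rfl) <;> exact ⟨2, Ideal.subset_span (by simp)⟩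

/-- Over the domain `k[Z, W]`, if `(a + bε)(a' + b'ε) = 0` and `a' ≠ 0`, then `a = 0`, and next `b
a' = 0` gives `b = 0`. -/
theorem isPrimary_J : (J k n).IsPrimary := by
  rw [Ideal.isPrimary_iff]
  constructor
  · intro h
    have h1 : (1 : MvPolynomial (Fin 4) k) ∈ J k n := by rw [h]; trivial
    rw [mem_J_iff, map_one] at h1
    exact one_ne_zero h1
  · intro f g hfg
    rw [radical_J, ← fst_dualHom_eq_zero_iff, mem_J_iff]
    rw [mem_J_iff, map_mul] at hfg
    by_contra! hne
    have h0 := congrArg TrivSqZeroExt.fst hfg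
    have h1 := congrArg TrivSqZeroExt.snd hfg
    rw [TrivSqZeroExt.fst_mul, TrivSqZeroExt.fst_zero] at h0
    have h2 := (mul_eq_zero.1 h0).resolve_right hne.2
    rw [TrivSqZeroExt.snd_mul, TrivSqZeroExt.snd_zero, h2, zero_smul, zero_add,
      op_smul_eq_mul] at h1
    exact hne.1 (TrivSqZeroExt.ext h2 ((mul_eq_zero.1 h1).resolve_right hne.2))

end Primary

end AbhyankarFamily

/-! ### Initial forms of power series. -/

section InitialForm

variable {σ : Type*} [Fintype σ] [DecidableEq σ] {k : Type*} [Field k]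

theorem coeff_initialForm (f : MvPowerSeries σ k) (d : σ →₀ ℕ) :
    (initialForm f).coeff d = if d.degree = f.order.toNat then MvPowerSeries.coeff d f else 0 := by
  rw [initialForm, MvPolynomial.coeff_sum]
  simp only [MvPolynomial.coeff_monomial]
  rw [Finset.sum_ite_eq']
  simp [Finset.mem_finsuppAntidiag, Finsupp.degree_eq_sum]

theorem isHomogeneous_initialForm (f : MvPowerSeries σ k) :
    (initialForm f).IsHomogeneous f.order.toNat := by
  intro d hd
  rw [coeff_initialForm] at hd
  refine (DFunLike.congr_fun Finsupp.degree_eq_weight_one d).symm.trans ?_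
  by_contra h
  exact hd (if_neg h)

theorem sub_initialForm_mem {f : MvPowerSeries σ k} (hf : f ≠ 0) :
    f - (initialForm f : MvPowerSeries σ k) ∈
      Ideal.span (Set.range MvPowerSeries.X) ^ (f.order.toNat + 1) := by
  rw [MvPowerSeries.mem_span_X_pow_iff]
  intro d hd
  rw [map_sub, MvPolynomial.coeff_coe, coeff_initialForm]
  split_ifs with h
  · exact sub_self _
  · rw [sub_zero]
    apply MvPowerSeries.coeff_of_lt_order
    rw [← MvPowerSeries.ne_zero_iff_order_finite.1 hf]
    exact_mod_cast (by lia : d.degree < f.order.toNat)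

/-- A nonzero form of degree `j` that agrees with `f` up to terms of order `j + 1` fixes both the
order and the leading part of `f`. -/
theorem initialForm_eq {f : MvPowerSeries σ k} {g : MvPolynomial σ k} {j : ℕ}
    (hg : g.IsHomogeneous j) (hg0 : g ≠ 0)
    (h : f - g ∈ Ideal.span (Set.range MvPowerSeries.X) ^ (j + 1)) :
    f ≠ 0 ∧ initialForm f = g := by
  rw [MvPowerSeries.mem_span_X_pow_iff] at h
  have hc : ∀ d : σ →₀ ℕ, d.degree < j + 1 → MvPowerSeries.coeff d f = g.coeff d := by
    intro d hd
    have := h d hd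
    rwa [map_sub, MvPolynomial.coeff_coe, sub_eq_zero] at this
  have hz : ∀ d : σ →₀ ℕ, d.degree ≠ j → g.coeff d = 0 := fun d hd => hg.coeff_eq_zero hd
  obtain ⟨d, hd⟩ := MvPolynomial.ne_zero_iff.1 hg0
  have hdj : d.degree = j := by
    by_contra hne
    exact hd (hz d hne)
  have hd' : MvPowerSeries.coeff d f ≠ 0 := by rwa [hc d (by lia)]
  have ho : f.order = j := by
    rw [MvPowerSeries.order_eq_nat]
    exact ⟨⟨d, hd', hdj⟩, fun e he => by rw [hc e (by lia), hz e (by lia)]⟩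
  refine ⟨fun h0 => hd' (by rw [h0, map_zero]), ?_⟩
  ext e
  rw [coeff_initialForm, ho, ENat.toNat_natCast]
  split_ifs with he
  · exact hc e (by lia)
  · exact (hz e he).symm

end InitialForm

/-! ### The initial ideal, the associated graded ring, and the graded Hilbert polynomial. -/

namespace AbhyankarFamily

variable {k : Type*} [Field k] {n : ℕ}

section Graded

attribute [local instance] moduleR

theorem aeval_mk_X (g : MvPolynomial (Fin 4) k) :
    MvPolynomial.aeval (fun i => Ideal.Quotient.mk (p k n) (MvPowerSeries.X i)) g =
      Ideal.Quotient.mk (p k n) (g : MvPowerSeries (Fin 4) k) := by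
  induction g using MvPolynomial.induction_on with
  | C a =>
    rw [MvPolynomial.aeval_C, MvPolynomial.coe_C]
    rfl
  | add f g hf hg => rw [map_add, hf, hg, MvPolynomial.coe_add, map_add]
  | mul_X f i hf => rw [map_mul, hf, MvPolynomial.aeval_X, MvPolynomial.coe_mul,
      MvPolynomial.coe_X, map_mul]

theorem mk_X_mem_pow_one (i : Fin 4) :
    Ideal.Quotient.mk (p k n) (MvPowerSeries.X i) ∈ maximalIdeal (R k n) ^ 1 := by
  rw [pow_one]
  exact mk_X_mem i

variable (k n) in
/-- The presentation of the associated graded ring of `R_n` by a polynomial ring. -/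
def gradedHom : MvPolynomial (Fin 4) k →ₐ[k] AssocGraded (maximalIdeal (R k n)) :=
  AssocGraded.polyHom (maximalIdeal (R k n)) _ mk_X_mem_pow_one

theorem gradedHom_eq_zero_iff {g : MvPolynomial (Fin 4) k} {m : ℕ} (hg : g.IsHomogeneous m) :
    gradedHom k n g = 0 ↔ Ideal.Quotient.mk (p k n) (g : MvPowerSeries (Fin 4) k) ∈
      maximalIdeal (R k n) ^ (m + 1) := by
  rw [gradedHom, AssocGraded.polyHom_eq_zero_iff_of_isHomogeneous _ _ _ hg, aeval_mk_X]

theorem exists_sub_mem_pow {j : ℕ} {a : R k n} (ha : a ∈ maximalIdeal (R k n) ^ j) :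
    ∃ g : MvPolynomial (Fin 4) k, g.IsHomogeneous j ∧
      a - Ideal.Quotient.mk (p k n) (g : MvPowerSeries (Fin 4) k) ∈
        maximalIdeal (R k n) ^ (j + 1) := by
  refine ⟨∑ e, MvPolynomial.monomial e.1 (symbol k n j a e), ?_, ?_⟩
  · exact MvPolynomial.IsHomogeneous.sum _ _ _ fun e _ =>
      MvPolynomial.isHomogeneous_monomial _ (mem_normalExps.1 e.2).2
  · rw [← symbol_eq_zero_iff (sub_mem ha (mk_sum_monomial_mem _)), map_sub, symbol_sum_monomial,
      sub_self]

theorem gradedHom_surjective : Function.Surjective (gradedHom k n) := by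
  apply AssocGraded.polyHom_surjective
  intro j a ha
  obtain ⟨g, hg, h⟩ := exists_sub_mem_pow ha
  exact ⟨g, hg, by rwa [aeval_mk_X]⟩

/-- The subtracted monomials in the first three generators of `𝔭_n` have degree `2n + 2 ≥ 3`, which
is where `n ≥ 1` enters. The fourth generator is already homogeneous. -/
theorem J_le_initialIdeal (hn : 1 ≤ n) : J k n ≤ initialIdeal (p k n) := by
  have key : ∀ (f : MvPowerSeries (Fin 4) k) (g : MvPolynomial (Fin 4) k) (j : ℕ), f ∈ p k n →
      g.IsHomogeneous j → g ≠ 0 → f - g ∈ Ideal.span (Set.range MvPowerSeries.X) ^ (j + 1) →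
      g ∈ initialIdeal (p k n) := by
    intro f g j hf hg hg0 h
    obtain ⟨h1, h2⟩ := initialForm_eq hg hg0 h
    exact Ideal.subset_span ⟨f, hf, h1, h2.symm⟩
  have hX : ∀ i, (MvPowerSeries.X i : MvPowerSeries (Fin 4) k) ∈
      Ideal.span (Set.range MvPowerSeries.X) := fun i => Ideal.subset_span ⟨i, rfl⟩
  have hmon : ∀ a b : ℕ, 3 ≤ a + b → ∀ f : MvPowerSeries (Fin 4) k,
      f - (f - MvPowerSeries.X 2 ^ a * MvPowerSeries.X 3 ^ b) ∈
        Ideal.span (Set.range MvPowerSeries.X) ^ 3 := by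
    intro a b hab f
    rw [sub_sub_cancel]
    refine Ideal.pow_le_pow_right hab ?_
    rw [pow_add]
    exact Ideal.mul_mem_mul (Ideal.pow_mem_pow (hX 2) a) (Ideal.pow_mem_pow (hX 3) b)
  have hdeg : ∀ i, (MvPolynomial.X i : MvPolynomial (Fin 4) k).IsHomogeneous 1 :=
    MvPolynomial.isHomogeneous_X k
  rw [J, Ideal.span_le]
  intro g hg
  simp only [Set.mem_insert_iff, Set.mem_singleton_iff] at hg
  rcases hg with rfl | rfl | rfl | rfl
  · refine key (MvPowerSeries.X 0 ^ 2 - MvPowerSeries.X 2 ^ (2 * n + 1) * MvPowerSeries.X 3) _ 2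
      (Ideal.subset_span (by simp)) ((hdeg 0).pow 2) (pow_ne_zero _ (MvPolynomial.X_ne_zero _)) ?_
    rw [← neg_mem_iff, neg_sub, MvPolynomial.coe_pow, MvPolynomial.coe_X]
    simpa using hmon (2 * n + 1) 1 (by lia) (MvPowerSeries.X 0 ^ 2)
  · refine key (MvPowerSeries.X 0 * MvPowerSeries.X 1 -
      MvPowerSeries.X 2 ^ (n + 1) * MvPowerSeries.X 3 ^ (n + 1)) _ 2
      (Ideal.subset_span (by simp)) ((hdeg 0).mul (hdeg 1))
      (mul_ne_zero (MvPolynomial.X_ne_zero _) (MvPolynomial.X_ne_zero _)) ?_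
    rw [← neg_mem_iff, neg_sub, MvPolynomial.coe_mul, MvPolynomial.coe_X, MvPolynomial.coe_X]
    exact hmon (n + 1) (n + 1) (by lia) _
  · refine key (MvPowerSeries.X 1 ^ 2 - MvPowerSeries.X 2 * MvPowerSeries.X 3 ^ (2 * n + 1)) _ 2
      (Ideal.subset_span (by simp)) ((hdeg 1).pow 2) (pow_ne_zero _ (MvPolynomial.X_ne_zero _)) ?_
    rw [← neg_mem_iff, neg_sub, MvPolynomial.coe_pow, MvPolynomial.coe_X]
    simpa using hmon 1 (2 * n + 1) (by lia) (MvPowerSeries.X 1 ^ 2)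
  · refine key (MvPowerSeries.X 1 * MvPowerSeries.X 2 ^ n - MvPowerSeries.X 0 *
      MvPowerSeries.X 3 ^ n) _ (1 + 1 * n) (Ideal.subset_span (by simp))
      (((hdeg 1).mul ((hdeg 2).pow n)).sub ((hdeg 0).mul ((hdeg 3).pow n))) ?_ ?_
    · intro h
      -- At this point the form takes the value `1`.
      have := congrArg (MvPolynomial.eval ![0, 1, 1, 0]) h
      simp at this
    · have : ((MvPolynomial.X 1 * MvPolynomial.X 2 ^ n - MvPolynomial.X 0 * MvPolynomial.X 3 ^ n :
          MvPolynomial (Fin 4) k) : MvPowerSeries (Fin 4) k) = MvPowerSeries.X 1 *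
          MvPowerSeries.X 2 ^ n - MvPowerSeries.X 0 * MvPowerSeries.X 3 ^ n := by
        rw [← MvPolynomial.coeToMvPowerSeries.ringHom_apply, map_sub, map_mul, map_mul, map_pow,
          map_pow]
        simp only [MvPolynomial.coeToMvPowerSeries.ringHom_apply, MvPolynomial.coe_X]
      rw [this, sub_self]
      exact zero_mem _

/-- For `f ∈ 𝔭_n` the class of `in(f)` in `R_n` is that of `in(f) - f`, which has higher order. -/
theorem initialIdeal_le_ker : initialIdeal (p k n) ≤ RingHom.ker (gradedHom k n) := by
  rw [initialIdeal, Ideal.span_le]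
  rintro _ ⟨f, hf, hf0, rfl⟩
  rw [SetLike.mem_coe, RingHom.mem_ker, gradedHom_eq_zero_iff (isHomogeneous_initialForm f)]
  have h := mk_mem_maximalIdeal_pow (n := n) (sub_initialForm_mem hf0)
  rwa [map_sub, Ideal.Quotient.eq_zero_iff_mem.2 hf, zero_sub, neg_mem_iff] at h

/-- Homogeneous components of such a `g` are their own normal forms, so a component of degree `m`
lies in `𝔪^{m+1}` only if it vanishes. -/
theorem eq_zero_of_mem_normalPolys {g : MvPolynomial (Fin 4) k} (hg : g ∈ normalPolys k n)
    (h : gradedHom k n g = 0) : g = 0 := by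
  rw [gradedHom, AssocGraded.polyHom_eq_zero_iff] at h
  ext d
  have h1 := h d.degree
  rw [aeval_mk_X, mem_maximalIdeal_pow_iff] at h1
  have h2 := h1 d (by lia)
  rw [nf_mk, normalForm_eq_self] at h2
  · simpa [MvPolynomial.coeff_homogeneousComponent] using h2
  · intro e he
    rw [MvPolynomial.coeff_coe, MvPolynomial.coeff_homogeneousComponent, hg e he, ite_self]

/-- Modulo `J`, which lies in the kernel, `g` may be replaced by a combination of normal monomials,
and such a combination in the kernel is zero. -/
theorem ker_gradedHom_le (hn : 1 ≤ n) : RingHom.ker (gradedHom k n) ≤ J k n := by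
  intro g hg
  obtain ⟨h1, h2⟩ := dualLift_dualHom (n := n) g
  have h3 := initialIdeal_le_ker (J_le_initialIdeal hn h2)
  rw [RingHom.mem_ker, map_sub, (RingHom.mem_ker).1 hg, zero_sub, neg_eq_zero] at h3
  rwa [eq_zero_of_mem_normalPolys h1 h3, sub_zero] at h2

theorem initialIdeal_p (hn : 1 ≤ n) : initialIdeal (p k n) = J k n :=
  le_antisymm (initialIdeal_le_ker.trans (ker_gradedHom_le hn)) (J_le_initialIdeal hn)

theorem ker_gradedHom (hn : 1 ≤ n) : RingHom.ker (gradedHom k n) = initialIdeal (p k n) :=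
  le_antisymm ((ker_gradedHom_le hn).trans (J_le_initialIdeal hn)) initialIdeal_le_ker

/-- `G_n` is the associated graded ring of `R_n`. -/
theorem exists_algEquiv_assocGraded (hn : 1 ≤ n) :
    ∃ e : G k n ≃ₐ[k] AssocGraded (maximalIdeal (R k n)),
      ∀ i : Fin 4, ∃ hi : Ideal.Quotient.mk (p k n) (MvPowerSeries.X i) ∈
          maximalIdeal (R k n) ^ 1,
        e (Ideal.Quotient.mk _ (MvPolynomial.X i)) = AssocGraded.of _ 1 _ hi :=
  ⟨(Ideal.quotientEquivAlgOfEq k (ker_gradedHom hn).symm).trans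
    (Ideal.quotientKerAlgEquivOfSurjective gradedHom_surjective), fun i =>
    ⟨mk_X_mem_pow_one i, AssocGraded.polyHom_X _ _ _ i⟩⟩

theorem gradedHilbertFunction_initialIdeal (hn : 1 ≤ n) (j : ℕ) :
    gradedHilbertFunction (initialIdeal (p k n)) j = 2 * j + 1 + min j n := by
  let coeL : MvPolynomial (Fin 4) k →ₗ[k] R k n :=
    (MvPolynomial.aeval fun i => Ideal.Quotient.mk (p k n) (MvPowerSeries.X i)).toLinearMap
  let L : ↥(MvPolynomial.homogeneousSubmodule (Fin 4) k j) →ₗ[k] (normalExps n j → k) :=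
    symbol k n j ∘ₗ coeL ∘ₗ Submodule.subtype _
  let M : ↥(MvPolynomial.homogeneousSubmodule (Fin 4) k j) →ₗ[k] G k n :=
    (Ideal.Quotient.mkₐ k (initialIdeal (p k n))).toLinearMap ∘ₗ Submodule.subtype _
  have hcoe : ∀ g, coeL g = Ideal.Quotient.mk (p k n) (g : MvPowerSeries (Fin 4) k) := aeval_mk_X
  have hL : Function.Surjective L := by
    intro v
    refine ⟨⟨∑ e, MvPolynomial.monomial e.1 (v e), ?_⟩, ?_⟩
    · exact MvPolynomial.IsHomogeneous.sum _ _ _ fun e _ =>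
        MvPolynomial.isHomogeneous_monomial _ (mem_normalExps.1 e.2).2
    · change symbol k n j (coeL _) = v
      rw [hcoe]
      exact symbol_sum_monomial v
  -- For a form of degree `j`, vanishing in `G_n` and vanishing of its symbol both mean that its
  -- class lies in `𝔪^{j+1}`.
  have hker : LinearMap.ker M = LinearMap.ker L := by
    ext ⟨g, hg⟩
    rw [LinearMap.mem_ker, LinearMap.mem_ker]
    change Ideal.Quotient.mk _ g = 0 ↔ symbol k n j (coeL g) = 0
    have hgj : Ideal.Quotient.mk (p k n) (g : MvPowerSeries (Fin 4) k) ∈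
        maximalIdeal (R k n) ^ j := by
      apply mk_mem_maximalIdeal_pow
      rw [MvPowerSeries.mem_span_X_pow_iff]
      intro d hd
      rw [MvPolynomial.coeff_coe]
      exact MvPolynomial.IsHomogeneous.coeff_eq_zero hg hd.ne
    rw [Ideal.Quotient.eq_zero_iff_mem, ← ker_gradedHom hn, RingHom.mem_ker,
      gradedHom_eq_zero_iff hg, hcoe, symbol_eq_zero_iff hgj]
  have hrange : (MvPolynomial.homogeneousSubmodule (Fin 4) k j).map
      (Ideal.Quotient.mkₐ k (initialIdeal (p k n))).toLinearMap = LinearMap.range M := by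
    rw [LinearMap.range_comp, Submodule.range_subtype]
  rw [gradedHilbertFunction, hrange, ← M.quotKerEquivRange.finrank_eq,
    (Submodule.quotEquivOfEq _ _ hker).finrank_eq, (L.quotKerEquivOfSurjective hL).finrank_eq,
    Module.finrank_fintype_fun_eq_card, Fintype.card_coe, card_normalExps]

theorem isGradedHilbertPolynomial_initialIdeal (hn : 1 ≤ n) :
    IsGradedHilbertPolynomial (initialIdeal (p k n)) (hilbertPoly n) := by
  filter_upwards [Filter.eventually_ge_atTop n] with j hj
  simp only [gradedHilbertFunction_initialIdeal hn]
  exact eval_hilbertPoly hj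

theorem eq_zero_or_mem_nilradical_of_mul_eq_zero (hn : 1 ≤ n) (x y : G k n) (h : x * y = 0) :
    x = 0 ∨ y ∈ nilradical (G k n) := by
  obtain ⟨f, rfl⟩ := Ideal.Quotient.mk_surjective x
  obtain ⟨g, rfl⟩ := Ideal.Quotient.mk_surjective y
  rw [← map_mul, Ideal.Quotient.eq_zero_iff_mem, initialIdeal_p hn] at h
  refine ((Ideal.isPrimary_iff.1 isPrimary_J).2 h).imp (fun h1 => ?_) (fun h1 => ?_)
  · rwa [Ideal.Quotient.eq_zero_iff_mem, initialIdeal_p hn]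
  · obtain ⟨m, hm⟩ := h1
    refine ⟨m, ?_⟩
    rwa [← map_pow, Ideal.zero_eq_bot, Ideal.mem_bot, Ideal.Quotient.eq_zero_iff_mem,
      initialIdeal_p hn]

end Graded

end AbhyankarFamily

end

/-! ### Assembly of the results. -/

theorem mainTheorem4 (k : Type*) [Field k] :
    (∀ n : ℕ, 1 ≤ n →
      -- `𝔭_n` is prime and `R_n` is a complete two-dimensional domain with isolated singularity
      (AbhyankarFamily.p k n).IsPrime ∧
      IsDomain (AbhyankarFamily.R k n) ∧
      ringKrullDim (AbhyankarFamily.R k n) = 2 ∧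
      IsNoetherianRing (AbhyankarFamily.R k n) ∧
      IsAdicComplete (IsLocalRing.maximalIdeal (AbhyankarFamily.R k n))
        (AbhyankarFamily.R k n) ∧
      HasIsolatedSingularity (AbhyankarFamily.R k n) ∧
      -- the substitution homomorphism induces `R_n ≅ k[[s t^{2n+1}, s^{2n+1} t, t², s²]]`
      (∃ e : AbhyankarFamily.R k n ≃ₐ[k] AbhyankarFamily.paramSubalgebra k n,
        ∀ f : MvPowerSeries (Fin 4) k,
          (e (Ideal.Quotient.mk (AbhyankarFamily.p k n) f) : MvPowerSeries (Fin 2) k) =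
            AbhyankarFamily.phi k n f) ∧
      -- numerical invariants, and the failure of Abhyankar's inequality in both of its forms
      (∃ h : Polynomial ℤ, IsHPolynomial (AbhyankarFamily.R k n) h) ∧
      hilbertCoeff (AbhyankarFamily.R k n) 0 = 2 ∧
      hilbertCoeff (AbhyankarFamily.R k n) 1 = 1 - (n : ℤ) ∧
      (IsLocalRing.maximalIdeal (AbhyankarFamily.R k n)).spanFinrank = 4 ∧
      (∃ c : ℕ, (AbhyankarFamily.p k n).height = c ∧
        hilbertCoeff (AbhyankarFamily.R k n) 0 < (c : ℤ) + 1) ∧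
      (∃ d : ℕ, ringKrullDim (AbhyankarFamily.R k n) = d ∧
        hilbertCoeff (AbhyankarFamily.R k n) 0 <
          ((IsLocalRing.maximalIdeal (AbhyankarFamily.R k n)).spanFinrank : ℤ) - d + 1) ∧
      -- `G_n = P / in(𝔭_n)` is the associated graded ring of `R_n`, each variable
      -- corresponding to the initial class of its residue
      (∃ e : AbhyankarFamily.G k n ≃ₐ[k]
          AssocGraded (IsLocalRing.maximalIdeal (AbhyankarFamily.R k n)),
        ∀ i : Fin 4, ∃ hi : Ideal.Quotient.mk (AbhyankarFamily.p k n) (MvPowerSeries.X i) ∈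
            IsLocalRing.maximalIdeal (AbhyankarFamily.R k n) ^ 1,
          e (Ideal.Quotient.mk _ (MvPolynomial.X i)) = AssocGraded.of _ 1 _ hi) ∧
      -- the initial ideal
      initialIdeal (AbhyankarFamily.p k n) = AbhyankarFamily.J k n ∧
      (initialIdeal (AbhyankarFamily.p k n)).IsPrimary ∧
      (initialIdeal (AbhyankarFamily.p k n)).radical =
        Ideal.span {MvPolynomial.X 0, MvPolynomial.X 1} ∧
      SerreCondition 1 (AbhyankarFamily.G k n) ∧
      IsUnmixedRing (AbhyankarFamily.G k n)) ∧
    -- the Hilbert polynomials are pairwise distinct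
    (∃ HP : ℕ → Polynomial ℚ,
      (∀ n : ℕ, 1 ≤ n →
        IsHilbertPolynomial (AbhyankarFamily.R k n) (HP n) ∧
        IsGradedHilbertPolynomial (initialIdeal (AbhyankarFamily.p k n)) (HP n)) ∧
      ∀ n n' : ℕ, 1 ≤ n → 1 ≤ n' → n ≠ n' → HP n ≠ HP n') := by
  refine ⟨fun n hn => ?_, AbhyankarFamily.hilbertPoly, fun n hn =>
    ⟨AbhyankarFamily.isHilbertPolynomial_R,
      AbhyankarFamily.isGradedHilbertPolynomial_initialIdeal hn⟩,
    fun n n' _ _ hne h => hne (AbhyankarFamily.hilbertPoly_injective h)⟩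
  have hdim := AbhyankarFamily.ringKrullDim_R (k := k) (n := n)
  have hmul := AbhyankarFamily.eq_zero_or_mem_nilradical_of_mul_eq_zero (k := k) hn
  have h0 := AbhyankarFamily.hilbertCoeff_zero_R (k := k) hn hdim
  have hspan := AbhyankarFamily.spanFinrank_maximalIdeal_R (k := k) hn
  refine ⟨inferInstance, AbhyankarFamily.isDomain_R, hdim, inferInstance,
    AbhyankarFamily.isAdicComplete_R, AbhyankarFamily.hasIsolatedSingularity_R hn,
    AbhyankarFamily.exists_algEquiv_paramSubalgebra,
    ⟨_, AbhyankarFamily.isHPolynomial_hPoly hn hdim⟩, h0,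
    AbhyankarFamily.hilbertCoeff_one_R hn hdim, hspan, ?_, ⟨2, hdim, ?_⟩,
    AbhyankarFamily.exists_algEquiv_assocGraded hn, AbhyankarFamily.initialIdeal_p hn, ?_, ?_,
    serreCondition_one_of_mul_eq_zero hmul, isUnmixedRing_of_mul_eq_zero hmul⟩
  · obtain ⟨c, hc, h2⟩ := AbhyankarFamily.exists_height_p (k := k) (n := n)
    -- Only the lower bound `2 ≤ c` on the height matters, as `e(R_n) = 2`.
    exact ⟨c, hc, by rw [h0]; lia⟩
  · rw [h0, hspan]
    norm_num
  · rw [AbhyankarFamily.initialIdeal_p hn]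
    exact AbhyankarFamily.isPrimary_J
  · rw [AbhyankarFamily.initialIdeal_p hn]
    exact AbhyankarFamily.radical_J
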